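/- Let $N\ge 3$, let $D^{1,2}(\mathbb{R}^N)$ be the completion of $C_c^\infty(\mathbb{R}^N)$ for the norm $\|\nabla\phi\|_{L^2}$ (a space of functions in $L^{2N/(N-2)}(\mathbb{R}^N)$), and let $$\mathcal X=D^{1,2}(\mathbb{R}^N)\cap\{\phi\in C^{0,1}(\mathbb{R}^N):\|\nabla\phi\|_\infty\le 1\},$$ with the distance $\|\nabla\phi-\nabla\psi\|_{L^2}$. Let $\mathcal X^*$ be the set of linear functionals on the linear span of $\mathcal X$ that are continuous on $\mathcal X$. Given $\rho\in\mathcal X^*$, a weak solution of $$-\operatorname{div}\Big(\frac{\nabla\phi}{\sqrt{1-|\nabla\phi|^2}}\Big)=\rho\ \text{ in }\mathbb{R}^N,\qquad \lim_{|x|\to\infty}\phi(x)=0,$$ is a function $\phi\in\mathcal X$ with $|\nabla\phi|<1$ almost everywhere such that, for all $\psi\in\mathcal X$, the integrand below is integrable and $$\int_{\mathbb{R}^N}\frac{\nabla\phi\cdot\nabla\psi}{\sqrt{1-|\nabla\phi|^2}}\,dx=\langle\rho,\psi\rangle .$$ **Theorem.** Let $\rho$ be a radially symmetric function (that is, $\rho\circ\tau=\rho$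 a.e. for every $\tau\in O(N)$) such that $\rho\in L^s(\mathbb{R}^N)\cap L^\sigma(B_\delta(0))$ for some $s\in[1,\infty]$, $\sigma\in[N,\infty]$ and $\delta>0$, and suppose that $\rho$ defines an element of $\mathcal X^*$, i.e. there is an element of $\mathcal X^*$, again denoted $\rho$, with $\langle\rho,\psi\rangle=\int_{\mathbb{R}^N}\rho\psi\,dx$ for all $\psi\in\mathcal X\cap C_c^\infty(\mathbb{R}^N)$. Let $\phi_\rho$ be a weak solution of the above problem. Then $\phi_\rho\in C^1(\mathbb{R}^N)$. Moreover $\phi_\rho$ is radial, $\phi_\rho(x)=f(|x|)$ with $f\in C^1([0,\infty))$, and $f'(0)=0$; and for every compact $K\subset(0,\infty)$ there is $\varepsilon>0$ such that $|f'(r)|\le 1-\varepsilon$ for all $r\in K$. -/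

import Mathlib

open MeasureTheory Filter Topology Set
open scoped ENNReal ContDiff

namespace BornInfeld

/-- `ℝ^N` with its Euclidean norm. -/
abbrev E (N : ℕ) : Type := EuclideanSpace ℝ (Fin N)

/-- The critical Sobolev exponent `2^* = 2N / (N - 2)`, meant for `N ≥ 3`. -/
noncomputable def critExp (N : ℕ) : ℝ≥0∞ := ENNReal.ofReal (2 * (N : ℝ) / ((N : ℝ) - 2))

/-- `u` belongs to `D^{1,2}(ℝ^N)`, the completion of `C_c^∞(ℝ^N)` for the norm `‖∇ ·‖_{L²}`
(realised, for `N ≥ 3`, as a space of functions in `L^{2^*}`), and `g` is its gradient: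
there are test functions `v n` with `∇ (v n) → g` in `L²` and `v n → u` in `L^{2^*}`. -/
def HasD12Gradient {N : ℕ} (u : E N → ℝ) (g : E N → E N) : Prop :=
  MemLp u (critExp N) volume ∧ MemLp g 2 volume ∧
    ∃ v : ℕ → E N → ℝ,
      (∀ n, ContDiff ℝ ∞ (v n) ∧ HasCompactSupport (v n)) ∧
      Tendsto (fun n => eLpNorm (fun x => gradient (v n) x - g x) 2 volume) atTop (𝓝 0) ∧
      Tendsto (fun n => eLpNorm (fun x => v n x - u x) (critExp N) volume) atTop (𝓝 0)

/-- The space `𝒳 = D^{1,2}(ℝ^N) ∩ {φ ∈ C^{0,1}(ℝ^N) : ‖∇φ‖_∞ ≤ 1}`. A Lipschitz function is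
differentiable almost everywhere, and its pointwise gradient is its weak gradient. -/
def X (N : ℕ) : Set (E N → ℝ) :=
  {φ | (∃ K, LipschitzWith K φ) ∧ HasD12Gradient φ (gradient φ) ∧
    ∀ᵐ x ∂(volume : Measure (E N)), ‖gradient φ x‖ ≤ 1}

/-- The dual `𝒳^*`. As `𝒳` is convex and symmetric but not a vector space, its elements are the
linear functionals on the linear span of `𝒳` that are continuous on `𝒳` for the distance
`‖∇φ - ∇ψ‖_{L²}`. -/
structure XDual (N : ℕ) where
  toLin : Submodule.span ℝ (X N) →ₗ[ℝ] ℝ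
  continuous_on_X : ∀ (u : ℕ → E N → ℝ) (ψ : E N → ℝ) (hu : ∀ n, u n ∈ X N) (hψ : ψ ∈ X N),
    Tendsto (fun n => eLpNorm (fun x => gradient (u n) x - gradient ψ x) 2 volume)
      atTop (𝓝 0) →
    Tendsto (fun n => toLin ⟨u n, Submodule.subset_span (hu n)⟩) atTop
      (𝓝 (toLin ⟨ψ, Submodule.subset_span hψ⟩))

/-- The duality pairing `⟨T, ψ⟩` between `𝒳^*` and `𝒳`. -/
def XDual.pairing {N : ℕ} (T : XDual N) (ψ : E N → ℝ) (hψ : ψ ∈ X N) : ℝ :=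
  T.toLin ⟨ψ, Submodule.subset_span hψ⟩

/-- The functional `T ∈ 𝒳^*` is given by the function `ρ`: `⟨T, ψ⟩ = ∫ ρ ψ` for the test functions
`ψ ∈ C_c^∞(ℝ^N)`. By linearity it is enough to say this for test functions in `𝒳`. -/
def XDual.IsGivenBy {N : ℕ} (T : XDual N) (ρ : E N → ℝ) : Prop :=
  ∀ (ψ : E N → ℝ) (hψ : ψ ∈ X N), ContDiff ℝ ∞ ψ → HasCompactSupport ψ →
    T.pairing ψ hψ = ∫ x, ρ x * ψ x

/-- The integrand `(∇φ · ∇ψ) / √(1 - |∇φ|²)` of the weak formulation. -/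
noncomputable def weakIntegrand {N : ℕ} (φ ψ : E N → ℝ) (x : E N) : ℝ :=
  inner ℝ (gradient φ x) (gradient ψ x) / Real.sqrt (1 - ‖gradient φ x‖ ^ 2)

/-- `φ` is a weak solution of `-div (∇φ / √(1 - |∇φ|²)) = T`, `φ → 0` at infinity: `φ ∈ 𝒳` and
`∫ (∇φ · ∇ψ) / √(1 - |∇φ|²) = ⟨T, ψ⟩` for all `ψ ∈ 𝒳`. That the integral makes sense is part of
this: the denominator is nonzero almost everywhere and the integrand is integrable. -/
def IsWeakSolution {N : ℕ} (T : XDual N) (φ : E N → ℝ) : Prop :=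
  φ ∈ X N ∧ (∀ᵐ x ∂(volume : Measure (E N)), ‖gradient φ x‖ < 1) ∧
    ∀ (ψ : E N → ℝ) (hψ : ψ ∈ X N),
      Integrable (weakIntegrand φ ψ) volume ∧
      ∫ x, weakIntegrand φ ψ x = T.pairing ψ hψ

/-- Radial symmetry of (the almost-everywhere class of) a function: `ρ ∘ τ = ρ` for all
`τ ∈ O(N)`. -/
def IsRadial {N : ℕ} (ρ : E N → ℝ) : Prop :=
  ∀ τ : E N ≃ₗᵢ[ℝ] E N, (fun x => ρ (τ x)) =ᵐ[volume] ρ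

end BornInfeld

/-! The energy density `F(p) = 1 - √(1 - |p|²)` is strictly convex on the open unit ball, with
derivative `p / √(1 - |p|²)`, so the equation determines its solution. Reflection invariance of `ρ`
passes to `φ`: for a reflection `τ`, `φ` and `φ ∘ τ` have equal energy and their difference pairs to
zero with `ρ`, which forces their gradients to agree (`IsWeakSolution.comp_involution_eq`). As `ρ`
acts by integration only on test functions, invariance of the pairing on all of `𝒳` needs their
density (`exists_testFunction_approx`). Points of equal norm are exchanged by a reflection, hence
`φ(x) = f(|x|)`.

For radial `φ` the equation integrates once: with `M(r)` the integral of `ρ` over `B_r` and `ω` the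
area of the unit sphere, `ω r^(N-1) f' / √(1 - f'²) = -M(r)` for almost every `r > 0`
(`IsWeakSolution.flux_eq`). Solving for the slope, `f' = -Q / √(1 + Q²)` with `Q = M / (ω r^(N-1))`.
Local integrability of `ρ` makes `M` continuous, so `f'` agrees with a continuous function of
modulus less than 1 on `(0, ∞)`; this gives `C¹` regularity and the gap on compact sets. At the
origin, Hölder's inequality with exponent `N` bounds `|Q(r)|` by a multiple of the `L^N` norm of `ρ`
on `B_r`, which tends to 0 (`tendsto_flux_zero`). -/

namespace BornInfeld

variable {N : ℕ}

/-! ### Isometries and half-differences in `𝒳` -/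

theorem gradient_comp_isometry (φ : E N → ℝ) (τ : E N ≃ₗᵢ[ℝ] E N) (x : E N) :
    gradient (fun y => φ (τ y)) x = τ.symm (gradient φ (τ x)) := by
  refine ext_inner_right ℝ fun v => ?_
  rw [inner_gradient_left, LinearIsometryEquiv.inner_map_eq_flip, LinearIsometryEquiv.symm_symm,
    inner_gradient_left]
  have h := τ.toContinuousLinearEquiv.comp_right_fderiv (f := φ) (x := x)
  have h' : fderiv ℝ (fun y => φ (τ y)) x
      = (fderiv ℝ φ (τ x)).comp (τ.toContinuousLinearEquiv : E N →L[ℝ] E N) := h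
  rw [h']
  rfl

theorem measurable_gradient (φ : E N → ℝ) : Measurable (gradient φ) := by
  have : gradient φ = fun x => (InnerProductSpace.toDual ℝ (E N)).symm (fderiv ℝ φ x) := rfl
  rw [this]
  exact (InnerProductSpace.toDual ℝ (E N)).symm.continuous.measurable.comp (measurable_fderiv ℝ φ)

theorem hasGradientAt_of_differentiableAt_half_sub {φ ψ : E N → ℝ} {x : E N}
    (hφ : DifferentiableAt ℝ φ x) (hψ : DifferentiableAt ℝ ψ x) :
    HasGradientAt (fun y => (1 / 2 : ℝ) * (φ y - ψ y))
      ((1 / 2 : ℝ) • (gradient φ x - gradient ψ x)) x := by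
  rw [hasGradientAt_iff_hasFDerivAt, map_smul, map_sub, toDual_gradient, toDual_gradient]
  exact (hφ.hasFDerivAt.sub hψ.hasFDerivAt).const_mul _

theorem gradient_half_sub_ae {φ ψ : E N → ℝ} {K L : NNReal} (hφ : LipschitzWith K φ)
    (hψ : LipschitzWith L ψ) :
    ∀ᵐ x ∂(volume : Measure (E N)), gradient (fun y => (1 / 2 : ℝ) * (φ y - ψ y)) x =
      (1 / 2 : ℝ) • (gradient φ x - gradient ψ x) := by
  filter_upwards [hφ.ae_differentiableAt (μ := volume), hψ.ae_differentiableAt (μ := volume)]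
    with x h1 h2
  exact (hasGradientAt_of_differentiableAt_half_sub h1 h2).gradient

theorem comp_isometry_mem_X {φ : E N → ℝ} (hφ : φ ∈ X N) (τ : E N ≃ₗᵢ[ℝ] E N) :
    (fun x => φ (τ x)) ∈ X N := by
  obtain ⟨⟨K, hK⟩, ⟨hu, hg, v, hv, hvg, hvu⟩, hb⟩ := hφ
  have hτ := τ.measurePreserving
  have hgrad : ∀ w : E N → ℝ, gradient (fun y => w (τ y)) = fun x => τ.symm (gradient w (τ x)) :=
    fun w => funext (gradient_comp_isometry w τ)
  refine ⟨⟨K * 1, hK.comp τ.lipschitz⟩, ⟨hu.comp_measurePreserving hτ, ?_,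
    fun n x => v n (τ x), fun n => ⟨(hv n).1.comp τ.contDiff,
      (hv n).2.comp_homeomorph τ.toHomeomorph⟩, ?_, ?_⟩, ?_⟩
  · rw [hgrad]
    exact (hg.comp_measurePreserving hτ).continuousLinearMap_comp
      (τ.symm.toContinuousLinearEquiv : E N →L[ℝ] E N)
  · refine hvg.congr fun n => ?_
    have hm : AEStronglyMeasurable (fun x => gradient (v n) x - gradient φ x) volume :=
      ((measurable_gradient _).sub (measurable_gradient _)).aestronglyMeasurable
    rw [← eLpNorm_comp_measurePreserving hm hτ]
    refine eLpNorm_congr_norm_ae (Eventually.of_forall fun x => ?_)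
    simp only [hgrad, ← map_sub, LinearIsometryEquiv.norm_map, Function.comp]
  · refine hvu.congr fun n => ?_
    have hm : AEStronglyMeasurable (fun x => v n x - φ x) volume :=
      ((hv n).1.continuous.sub hK.continuous).aestronglyMeasurable
    rw [← eLpNorm_comp_measurePreserving hm hτ]
    rfl
  · rw [hgrad]
    filter_upwards [hτ.quasiMeasurePreserving.ae hb] with x hx
    simpa using hx

theorem one_le_critExp (hN : 3 ≤ N) : 1 ≤ critExp N := by
  have h3 : (3 : ℝ) ≤ N := by exact_mod_cast hN
  rw [critExp, ENNReal.one_le_ofReal, le_div_iff₀ (by linarith)]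
  linarith

/-- `𝒳` is convex and symmetric but not closed under subtraction; the factor 1/2 keeps the gradient
in the unit ball. -/
theorem half_sub_mem_X (hN : 3 ≤ N) {φ ψ : E N → ℝ} (hφ : φ ∈ X N) (hψ : ψ ∈ X N) :
    (fun x => (1 / 2 : ℝ) * (φ x - ψ x)) ∈ X N := by
  obtain ⟨⟨K, hK⟩, ⟨hu, hg, v, hv, hvg, hvu⟩, hb⟩ := hφ
  obtain ⟨⟨L, hL⟩, ⟨hu', hg', v', hv', hvg', hvu'⟩, hb'⟩ := hψ
  have hae := gradient_half_sub_ae hK hL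
  have hlip : LipschitzWith (K + L) (fun x => (1 / 2 : ℝ) * (φ x - ψ x)) := by
    refine LipschitzWith.of_dist_le_mul fun x y => ?_
    have h := (hK.sub hL).dist_le_mul x y
    rw [Real.dist_eq] at h ⊢
    rw [← mul_sub, abs_mul]
    have h0 := abs_nonneg (φ x - ψ x - (φ y - ψ y))
    norm_num
    push_cast at h
    linarith
  refine ⟨⟨_, hlip⟩, ⟨(hu.sub hu').const_mul _, ?_,
    fun n x => (1 / 2 : ℝ) * (v n x - v' n x), fun n => ⟨?_, ?_⟩, ?_, ?_⟩, ?_⟩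
  · exact ((hg.sub hg').const_smul (1 / 2 : ℝ)).ae_eq (by
      filter_upwards [hae] with x hx using hx.symm)
  · exact contDiff_const.mul ((hv n).1.sub (hv' n).1)
  · exact (HasCompactSupport.sub (hv n).2 (hv' n).2).mul_left
  · have h0 := hvg.add hvg'
    rw [add_zero] at h0
    refine tendsto_of_tendsto_of_tendsto_of_le_of_le tendsto_const_nhds h0 (fun _ => zero_le)
      fun n => ?_
    refine le_trans (eLpNorm_mono_ae (g := fun x => (gradient (v n) x - gradient φ x)
      - (gradient (v' n) x - gradient ψ x)) ?_) (eLpNorm_sub_le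
        ((measurable_gradient _).sub (measurable_gradient _)).aestronglyMeasurable
        ((measurable_gradient _).sub (measurable_gradient _)).aestronglyMeasurable (by norm_num))
    filter_upwards [hae] with x hx
    rw [hx, (hasGradientAt_of_differentiableAt_half_sub
      ((hv n).1.differentiable (by simp) x) ((hv' n).1.differentiable (by simp) x)).gradient,
      ← smul_sub, norm_smul, sub_sub_sub_comm]
    norm_num
    linarith [norm_nonneg (gradient (v n) x - gradient φ x - (gradient (v' n) x - gradient ψ x))]
  · have h0 := hvu.add hvu'
    rw [add_zero] at h0
    refine tendsto_of_tendsto_of_tendsto_of_le_of_le tendsto_const_nhds h0 (fun _ => zero_le)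
      fun n => ?_
    refine le_trans (eLpNorm_mono (g := fun x => (v n x - φ x) - (v' n x - ψ x)) fun x => ?_)
      (eLpNorm_sub_le ((hv n).1.continuous.sub hK.continuous).aestronglyMeasurable
        ((hv' n).1.continuous.sub hL.continuous).aestronglyMeasurable (one_le_critExp hN))
    rw [← mul_sub, sub_sub_sub_comm, norm_mul]
    norm_num
    linarith [abs_nonneg (v n x - φ x - (v' n x - ψ x))]
  · filter_upwards [hae, hb, hb'] with x hx h1 h2
    rw [hx, norm_smul]
    have := norm_sub_le (gradient φ x) (gradient ψ x)
    norm_num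
    linarith

/-! ### Density of test functions in `𝒳` -/

theorem tendsto_eLpNorm_two_of_dominated {α F : Type*} [MeasurableSpace α] {μ : Measure α}
    [NormedAddCommGroup F] {f : ℕ → α → F} {g : α → ℝ} (hf : ∀ n, AEStronglyMeasurable (f n) μ)
    (hg : MemLp g 2 μ) (hfg : ∀ n, ∀ᵐ x ∂μ, ‖f n x‖ ≤ g x)
    (hlim : ∀ᵐ x ∂μ, Tendsto (fun n => f n x) atTop (𝓝 0)) :
    Tendsto (fun n => eLpNorm (f n) 2 μ) atTop (𝓝 0) := by
  have key : Tendsto (fun n => ∫⁻ x, ‖f n x‖ₑ ^ (2 : ℝ) ∂μ) atTop (𝓝 (∫⁻ _, 0 ∂μ)) := by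
    refine tendsto_lintegral_of_dominated_convergence' (fun x => ‖g x‖ₑ ^ (2 : ℝ))
      (fun n => (hf n).enorm.pow_const _) (fun n => ?_) ?_ ?_
    · filter_upwards [hfg n] with x hx
      gcongr
      rw [enorm_le_iff_norm_le]
      exact hx.trans (le_abs_self _)
    · have := (lintegral_rpow_enorm_lt_top_of_eLpNorm_lt_top (by norm_num) (by norm_num) hg.2).ne
      simpa using this
    · filter_upwards [hlim] with x hx
      have h1 : Tendsto (fun n => ‖f n x‖ₑ) atTop (𝓝 0) := by simpa using hx.enorm
      simpa using h1.ennrpow_const 2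
  simp_rw [eLpNorm_eq_lintegral_rpow_enorm_toReal (two_ne_zero) (ENNReal.ofNat_ne_top (n := 2))]
  have := key.ennrpow_const (1 / (2 : ℝ≥0∞).toReal)
  simpa using this

theorem gradient_eq_zero_ae_of_eq_zero (hN : 0 < N) {ψ : E N → ℝ} {K : NNReal}
    (hψ : LipschitzWith K ψ) :
    ∀ᵐ x ∂(volume : Measure (E N)), ψ x = 0 → gradient ψ x = 0 := by
  have : Nonempty (Fin N) := ⟨⟨0, hN⟩⟩
  obtain ⟨e, he⟩ := exists_norm_eq (E N) zero_le_one
  set s : Set (E N) := {x | ψ x = 0} ∩ {x | DifferentiableAt ℝ ψ x} with hs_def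
  have hs : MeasurableSet s :=
    (isClosed_eq hψ.continuous continuous_const).measurableSet.inter
      (measurableSet_of_differentiableAt ℝ ψ)
  -- On its zero set `ψ` is approximated by the zero map with constant 0, so its derivative vanishes
  -- there almost everywhere. The factor `e` makes `ψ` a self-map of the space, as the lemma applied
  -- next requires.
  have happ : ApproximatesLinearOn (fun x => ψ x • e) (0 : E N →L[ℝ] E N) s 0 := by
    intro x hx y hy
    have hx0 : ψ x = 0 := hx.1
    have hy0 : ψ y = 0 := hy.1
    simp [hx0, hy0]
  have h := happ.norm_fderiv_sub_le volume hs (fun x => (fderiv ℝ ψ x).smulRight e) fun x hx =>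
    (hx.2.hasFDerivAt.smul_const e).hasFDerivWithinAt
  rw [ae_restrict_iff' hs] at h
  filter_upwards [h, hψ.ae_differentiableAt (μ := volume)] with x hx hd h0
  have h1 := hx ⟨h0, hd⟩
  have he0 : e ≠ 0 := by
    rintro rfl
    simp at he
  have h3 : fderiv ℝ ψ x = 0 := by simpa [he0] using h1
  rw [gradient, h3, map_zero]

/-- The set `|ψ| ≥ ε/2` has finite measure, so its far part is smaller in measure than a fixed ball.
By the Lipschitz bound, a far point with `|ψ| ≥ ε` would put a whole such ball inside it. -/
theorem exists_radius_abs_lt {ψ : E N → ℝ} {K : NNReal} (hψ : LipschitzWith K ψ) {p : ℝ≥0∞}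
    (hp0 : p ≠ 0) (hp : p ≠ ⊤) (hmem : MemLp ψ p volume) {ε : ℝ} (hε : 0 < ε) :
    ∃ R : ℝ, ∀ x, R < ‖x‖ → |ψ x| < ε := by
  set S : Set (E N) := {x | ε / 2 ≤ |ψ x|} with hS
  have hSm : MeasurableSet S :=
    (isClosed_le continuous_const hψ.continuous.abs).measurableSet
  have hSfin : volume S < ⊤ := by
    have h := hmem.meas_ge_lt_top hp0 hp (ε := ⟨ε / 2, by positivity⟩)
      (fun h => (half_pos hε).ne' (congrArg NNReal.toReal h))
    refine lt_of_le_of_lt (measure_mono fun x hx => ?_) h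
    exact hx
  set r : ℝ := ε / (2 * (K + 1)) with hr
  have hrpos : 0 < r := by positivity
  have hm : 0 < volume (Metric.ball (0 : E N) r) := Metric.measure_ball_pos _ _ hrpos
  have hlim : Tendsto (fun n : ℕ => volume (S ∩ {y | (n : ℝ) ≤ ‖y‖})) atTop (𝓝 0) := by
    have h := tendsto_measure_iInter_atTop (μ := (volume : Measure (E N)))
      (s := fun n : ℕ => S ∩ {y | (n : ℝ) ≤ ‖y‖})
      (fun n => (hSm.inter (isClosed_le continuous_const continuous_norm).measurableSet).nullMeasurableSet)
      (fun m n hmn x hx => ⟨hx.1, le_trans (by exact_mod_cast hmn) (show (n : ℝ) ≤ ‖x‖ from hx.2)⟩)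
      ⟨0, (lt_of_le_of_lt (measure_mono inter_subset_left) hSfin).ne⟩
    have hempty : (⋂ n : ℕ, S ∩ {y : E N | (n : ℝ) ≤ ‖y‖}) = ∅ := by
      refine eq_empty_of_forall_notMem fun x hx => ?_
      obtain ⟨n, hn⟩ := exists_nat_gt ‖x‖
      exact absurd (show (n : ℝ) ≤ ‖x‖ from (mem_iInter.1 hx n).2) (not_le.2 hn)
    rwa [hempty, measure_empty] at h
  obtain ⟨n, hn⟩ := (hlim.eventually (gt_mem_nhds hm)).exists
  refine ⟨n + r, fun x hx => ?_⟩
  by_contra! hcon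
  refine absurd hn (not_lt.2 ?_)
  rw [← Measure.addHaar_ball_center volume x r]
  refine measure_mono fun y hy => ?_
  rw [Metric.mem_ball] at hy
  have h1 := hψ.dist_le_mul x y
  rw [dist_comm x y, Real.dist_eq] at h1
  have h2 : (K : ℝ) * dist y x ≤ K * r := by gcongr
  have h3 : (K : ℝ) * r ≤ ε / 2 := by
    rw [hr, mul_div_assoc', div_le_div_iff₀ (by positivity) (by positivity)]
    nlinarith
  have h4 : |ψ x| ≤ |ψ x - ψ y| + |ψ y| := by
    simpa using abs_add_le (ψ x - ψ y) (ψ y)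
  refine ⟨show ε / 2 ≤ |ψ y| by linarith, show (n : ℝ) ≤ ‖y‖ from ?_⟩
  have h5 := norm_sub_norm_le x y
  rw [← dist_eq_norm, dist_comm] at h5
  linarith

theorem testFunction_mem_X {u : E N → ℝ} (hu : ContDiff ℝ ∞ u) (hc : HasCompactSupport u)
    (hb : ∀ x, ‖gradient u x‖ ≤ 1) : u ∈ X N := by
  obtain ⟨C, hC⟩ := ContDiff.lipschitzWith_of_hasCompactSupport hc hu (by simp)
  have hgc : Continuous (gradient u) :=
    (InnerProductSpace.toDual ℝ (E N)).symm.continuous.comp (hu.continuous_fderiv (by simp))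
  have hgs : HasCompactSupport (gradient u) :=
    (hc.fderiv ℝ).comp_left (map_zero (InnerProductSpace.toDual ℝ (E N)).symm)
  refine ⟨⟨C, hC⟩, ⟨hu.continuous.memLp_of_hasCompactSupport hc,
    hgc.memLp_of_hasCompactSupport hgs, fun _ => u, fun _ => ⟨hu, hc⟩, ?_, ?_⟩,
    Eventually.of_forall hb⟩ <;> simp

theorem hasGradientAt_convolution {k ψ : E N → ℝ} {K : NNReal} (hk : Continuous k)
    (hkc : HasCompactSupport k) (hψ : LipschitzWith K ψ) (x : E N) :
    HasGradientAt (convolution k ψ (ContinuousLinearMap.lsmul ℝ ℝ) volume)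
      (convolution k (gradient ψ) (ContinuousLinearMap.lsmul ℝ ℝ) volume x) x := by
  have hmp : MeasurePreserving (fun t : E N => x - t) volume volume :=
    Measure.measurePreserving_sub_left volume x
  have h := hasFDerivAt_integral_of_dominated_loc_of_lip (μ := (volume : Measure (E N)))
    (s := univ) (x₀ := x) (F := fun y t => k t * ψ (y - t)) (bound := fun t => K * ‖k t‖)
    (F' := fun t => InnerProductSpace.toDual ℝ (E N) (k t • gradient ψ (x - t)))
    univ_mem
    (Eventually.of_forall fun y => Continuous.aestronglyMeasurable
      (hk.mul (hψ.continuous.comp (continuous_const.sub continuous_id))))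
    (Continuous.integrable_of_hasCompactSupport
      (hk.mul (hψ.continuous.comp (continuous_const.sub continuous_id))) hkc.mul_right)
    ((InnerProductSpace.toDual ℝ (E N)).continuous.comp_aestronglyMeasurable
      (hk.aestronglyMeasurable.smul
        ((measurable_gradient ψ).comp hmp.measurable).aestronglyMeasurable))
    (Eventually.of_forall fun t => ?_)
    ((hk.integrable_of_hasCompactSupport hkc).norm.const_mul _) ?_
  · have h2 := h.2
    have hint : Integrable (fun t => k t • gradient ψ (x - t)) volume :=
      h.1.mono (hk.aestronglyMeasurable.smul
        ((measurable_gradient ψ).comp hmp.measurable).aestronglyMeasurable)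
        (Eventually.of_forall fun t => by rw [LinearIsometryEquiv.norm_map])
    rw [hasGradientAt_iff_hasFDerivAt]
    convert! h2 using 1
    ext v
    rw [ContinuousLinearMap.integral_apply h.1]
    simp only [InnerProductSpace.toDual_apply_apply]
    rw [real_inner_comm]
    simp only [real_inner_comm v]
    rw [integral_inner hint]
    rfl
  · refine LipschitzOnWith.of_dist_le_mul fun y _ z _ => ?_
    have := hψ.dist_le_mul (y - t) (z - t)
    rw [dist_sub_right, Real.dist_eq] at this
    rw [Real.dist_eq, ← mul_sub, abs_mul, Real.coe_nnabs, Real.norm_eq_abs,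
      abs_of_nonneg (by positivity : 0 ≤ (K : ℝ) * |k t|)]
    calc |k t| * |ψ (y - t) - ψ (z - t)| ≤ |k t| * (K * dist y z) := by gcongr
      _ = _ := by ring
  · filter_upwards [hmp.quasiMeasurePreserving.ae (hψ.ae_differentiableAt (μ := volume))]
      with t ht
    rw [map_smul, toDual_gradient]
    exact ((hasFDerivAt_comp_sub t).2 ht.hasFDerivAt).const_mul _

/-- Mollification averages gradients, and averages of vectors in the unit ball stay there, so the
mollified functions remain in `𝒳`. -/
theorem exists_testFunction_approx_of_hasCompactSupport {ψ : E N → ℝ} {K : NNReal}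
    (hψ : LipschitzWith K ψ) (hc : HasCompactSupport ψ)
    (hb : ∀ᵐ x ∂(volume : Measure (E N)), ‖gradient ψ x‖ ≤ 1) {c : ℝ≥0∞} (hc0 : 0 < c) :
    ∃ u ∈ X N, ContDiff ℝ ∞ u ∧ HasCompactSupport u ∧
      eLpNorm (fun x => gradient u x - gradient ψ x) 2 volume < c := by
  let b : ℕ → ContDiffBump (0 : E N) := fun n =>
    { rIn := 1 / ((n : ℝ) + 1)
      rOut := 2 * (1 / ((n : ℝ) + 1))
      rIn_pos := by positivity
      rIn_lt_rOut := by
        have : (0 : ℝ) < 1 / ((n : ℝ) + 1) := by positivity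
        linarith }
  let k : ℕ → E N → ℝ := fun n => (b n).normed volume
  let u : ℕ → E N → ℝ := fun n =>
    convolution (k n) ψ (ContinuousLinearMap.lsmul ℝ ℝ) volume
  have hkc : ∀ n, Continuous (k n) := fun n => (b n).continuous_normed
  have hks : ∀ n, HasCompactSupport (k n) := fun n => (b n).hasCompactSupport_normed
  have hgrad : ∀ n x, gradient (u n) x =
      convolution (k n) (gradient ψ) (ContinuousLinearMap.lsmul ℝ ℝ) volume x := fun n x =>
    (hasGradientAt_convolution (hkc n) (hks n) hψ x).gradient
  have hub : ∀ n x, ‖gradient (u n) x‖ ≤ 1 := by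
    intro n x
    rw [hgrad]
    calc _ ≤ ∫ t, k n t := by
            refine norm_integral_le_of_norm_le (b n).integrable_normed ?_
            have hmp := Measure.measurePreserving_sub_left (volume : Measure (E N)) x
            filter_upwards [hmp.quasiMeasurePreserving.ae hb] with t ht
            rw [ContinuousLinearMap.lsmul_apply, norm_smul,
              Real.norm_of_nonneg ((b n).nonneg_normed t)]
            exact mul_le_of_le_one_right ((b n).nonneg_normed t) ht
      _ = 1 := (b n).integral_normed
  have hus : ∀ n, ContDiff ℝ ∞ (u n) := fun n =>
    (hks n).contDiff_convolution_left _ (b n).contDiff_normed hψ.continuous.locallyIntegrable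
  have huc : ∀ n, HasCompactSupport (u n) := fun n => (hks n).convolution _ hc
  have hint : LocallyIntegrable (gradient ψ) (volume : Measure (E N)) := by
    intro x
    refine ⟨Metric.ball x 1, Metric.ball_mem_nhds x one_pos, ?_⟩
    refine Measure.integrableOn_of_bounded (M := 1) measure_ball_lt_top.ne
      (measurable_gradient ψ).aestronglyMeasurable (ae_restrict_of_ae hb)
  have hconv : ∀ᵐ x ∂(volume : Measure (E N)),
      Tendsto (fun n => gradient (u n) x) atTop (𝓝 (gradient ψ x)) := by
    simp_rw [hgrad]
    refine ContDiffBump.ae_convolution_tendsto_right_of_locallyIntegrable (K := 2) ?_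
      (Eventually.of_forall fun n => le_rfl) hint
    have h : Tendsto (fun n : ℕ => 2 * (1 / ((n : ℝ) + 1))) atTop (𝓝 (2 * 0)) :=
      tendsto_one_div_add_atTop_nhds_zero_nat.const_mul 2
    rwa [mul_zero] at h
  obtain ⟨R, hR⟩ := hc.isCompact.isBounded.subset_closedBall (0 : E N)
  have hψ0 : ∀ y, R < ‖y‖ → ψ y = 0 := fun y hy => by
    refine image_eq_zero_of_notMem_tsupport fun h => ?_
    have := hR h
    rw [mem_closedBall_zero_iff] at this
    linarith
  have hopen : ∀ r : ℝ, IsOpen {y : E N | r < ‖y‖} := fun r =>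
    isOpen_lt continuous_const continuous_norm
  have hgψ0 : ∀ x, R + 2 < ‖x‖ → gradient ψ x = 0 := by
    intro x hx
    have h : ψ =ᶠ[𝓝 x] fun _ => (0 : ℝ) := by
      filter_upwards [(hopen (R + 2)).mem_nhds hx] with y hy
      exact hψ0 y (by have : R + 2 < ‖y‖ := hy; linarith)
    rw [h.gradient_eq, gradient_fun_const]
  have hgu0 : ∀ n x, R + 2 < ‖x‖ → gradient (u n) x = 0 := by
    intro n x hx
    have h : u n =ᶠ[𝓝 x] fun _ => (0 : ℝ) := by
      filter_upwards [(hopen (R + 2)).mem_nhds hx] with y hy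
      have hy' : R + 2 < ‖y‖ := hy
      refine integral_eq_zero_of_ae (Eventually.of_forall fun t => ?_)
      simp only [ContinuousLinearMap.lsmul_apply, Pi.zero_apply, smul_eq_mul, mul_eq_zero]
      by_contra! hcon
      have ht : t ∈ Metric.ball (0 : E N) (b n).rOut := by
        rw [← (b n).support_normed_eq (μ := volume)]
        exact hcon.1
      rw [mem_ball_zero_iff] at ht
      have h2 : (b n).rOut ≤ 2 := by
        change 2 * (1 / ((n : ℝ) + 1)) ≤ 2
        have : 1 / ((n : ℝ) + 1) ≤ 1 := by
          rw [div_le_one (by positivity)]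
          linarith [Nat.cast_nonneg (α := ℝ) n]
        linarith
      refine hcon.2 (hψ0 _ ?_)
      have := norm_sub_norm_le y t
      linarith
    rw [h.gradient_eq, gradient_fun_const]
  -- Both gradients are bounded by 1 almost everywhere, and vanish outside the ball of radius `R +
  -- 2` because the mollifiers have radius at most 2.
  have hlim := tendsto_eLpNorm_two_of_dominated (μ := (volume : Measure (E N)))
    (f := fun n x => gradient (u n) x - gradient ψ x)
    (g := (Metric.closedBall (0 : E N) (R + 2)).indicator fun _ => (2 : ℝ))
    (fun n => ((measurable_gradient _).sub (measurable_gradient _)).aestronglyMeasurable)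
    (memLp_indicator_const 2 Metric.isClosed_closedBall.measurableSet 2
      (Or.inr measure_closedBall_lt_top.ne))
    (fun n => ?_) ?_
  · obtain ⟨n, hn⟩ := (hlim.eventually (gt_mem_nhds hc0)).exists
    exact ⟨u n, testFunction_mem_X (hus n) (huc n) (hub n), hus n, huc n, hn⟩
  · filter_upwards [hb] with x hx
    by_cases hxR : ‖x‖ ≤ R + 2
    · rw [indicator_of_mem (by simpa using hxR)]
      have := norm_sub_le (gradient (u n) x) (gradient ψ x)
      linarith [hub n x]
    · rw [indicator_of_notMem (by simpa using hxR), hgu0 n x (not_le.1 hxR),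
        hgψ0 x (not_le.1 hxR)]
      simp
  · filter_upwards [hconv] with x hx
    simpa using hx.sub_const (gradient ψ x)

/-- A continuous cutoff of the neighbourhood `[-ε, ε]` of zero. -/
noncomputable def cutoff (ε s : ℝ) : ℝ := max 0 (min 1 (|s| / ε - 1))

theorem continuous_cutoff (ε : ℝ) : Continuous (cutoff ε) := by
  unfold cutoff
  fun_prop

theorem cutoff_nonneg (ε s : ℝ) : 0 ≤ cutoff ε s := le_max_left _ _

theorem cutoff_le_one (ε s : ℝ) : cutoff ε s ≤ 1 := max_le zero_le_one (min_le_left _ _)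

theorem cutoff_eq_zero {ε s : ℝ} (hε : 0 < ε) (hs : |s| ≤ ε) : cutoff ε s = 0 := by
  have : |s| / ε ≤ 1 := (div_le_one hε).2 hs
  exact max_eq_left ((min_le_right _ _).trans (by linarith))

theorem cutoff_eq_one {ε s : ℝ} (hε : 0 < ε) (hs : 2 * ε ≤ |s|) : cutoff ε s = 1 := by
  have : 2 ≤ |s| / ε := (le_div_iff₀ hε).2 hs
  rw [cutoff, min_eq_left (by linarith), max_eq_right zero_le_one]

/-- The soft threshold: a primitive of the cutoff. -/
noncomputable def softThreshold (ε t : ℝ) : ℝ := ∫ s in (0 : ℝ)..t, cutoff ε s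

theorem hasDerivAt_softThreshold (ε t : ℝ) :
    HasDerivAt (softThreshold ε) (cutoff ε t) t :=
  intervalIntegral.integral_hasDerivAt_right ((continuous_cutoff ε).intervalIntegrable _ _)
    (continuous_cutoff ε).aestronglyMeasurable.stronglyMeasurableAtFilter
    (continuous_cutoff ε).continuousAt

theorem softThreshold_eq_zero {ε t : ℝ} (hε : 0 < ε) (ht : |t| ≤ ε) : softThreshold ε t = 0 := by
  rw [softThreshold]
  refine (intervalIntegral.integral_congr (g := fun _ => (0 : ℝ)) fun s hs => ?_).trans (by simp)
  refine cutoff_eq_zero hε (le_trans ?_ ht)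
  have := abs_sub_left_of_mem_uIcc hs
  simpa using this

theorem lipschitzWith_softThreshold (ε : ℝ) : LipschitzWith 1 (softThreshold ε) := by
  refine lipschitzWith_of_nnnorm_deriv_le
    (fun t => (hasDerivAt_softThreshold ε t).differentiableAt) fun t => ?_
  rw [(hasDerivAt_softThreshold ε t).deriv, ← NNReal.coe_le_coe, coe_nnnorm,
    Real.norm_of_nonneg (cutoff_nonneg _ _)]
  exact cutoff_le_one _ _

theorem critExp_ne_top : critExp N ≠ ⊤ := ENNReal.ofReal_ne_top

/-- The truncation acts on values, not in space: the soft threshold has slope in `[0, 1]`, so the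
gradient bound survives, and decay of `ψ` gives compact support. The gradient changes only where
`|ψ| < 2ε`, and in the limit only on `ψ = 0`, where it vanishes almost everywhere. -/
theorem exists_testFunction_approx (hN : 3 ≤ N) {ψ : E N → ℝ} (hψ : ψ ∈ X N) :
    ∃ u : ℕ → E N → ℝ, (∀ n, u n ∈ X N ∧ ContDiff ℝ ∞ (u n) ∧ HasCompactSupport (u n)) ∧
      Tendsto (fun n => eLpNorm (fun x => gradient (u n) x - gradient ψ x) 2 volume)
        atTop (𝓝 0) := by
  obtain ⟨⟨K, hK⟩, ⟨hu, hg, -⟩, hb⟩ := hψ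
  let ε : ℕ → ℝ := fun n => 1 / ((n : ℝ) + 1)
  have hε : ∀ n, 0 < ε n := fun n => by positivity
  have hε0 : Tendsto ε atTop (𝓝 0) := tendsto_one_div_add_atTop_nhds_zero_nat
  let w : ℕ → E N → ℝ := fun n x => softThreshold (ε n) (ψ x)
  have hwlip : ∀ n, LipschitzWith (1 * K) (w n) := fun n =>
    (lipschitzWith_softThreshold (ε n)).comp hK
  have hwc : ∀ n, HasCompactSupport (w n) := fun n => by
    obtain ⟨R, hR⟩ := exists_radius_abs_lt hK
      (zero_lt_one.trans_le (one_le_critExp hN)).ne' critExp_ne_top hu (hε n)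
    refine HasCompactSupport.intro (isCompact_closedBall (0 : E N) R) fun x hx => ?_
    rw [mem_closedBall_zero_iff, not_le] at hx
    exact softThreshold_eq_zero (hε n) (hR x hx).le
  have hwg : ∀ n, ∀ᵐ x ∂(volume : Measure (E N)),
      gradient (w n) x = cutoff (ε n) (ψ x) • gradient ψ x := fun n => by
    filter_upwards [hK.ae_differentiableAt (μ := volume)] with x hx
    refine HasGradientAt.gradient ?_
    rw [hasGradientAt_iff_hasFDerivAt, map_smul, toDual_gradient]
    exact (hasDerivAt_softThreshold (ε n) (ψ x)).comp_hasFDerivAt x hx.hasFDerivAt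
  have hwb : ∀ n, ∀ᵐ x ∂(volume : Measure (E N)), ‖gradient (w n) x‖ ≤ 1 := fun n => by
    filter_upwards [hwg n, hb] with x hx hbx
    rw [hx, norm_smul, Real.norm_of_nonneg (cutoff_nonneg _ _)]
    exact mul_le_one₀ (cutoff_le_one _ _) (norm_nonneg _) hbx
  have hwlim : Tendsto (fun n => eLpNorm (fun x => gradient (w n) x - gradient ψ x) 2 volume)
      atTop (𝓝 0) := by
    refine tendsto_eLpNorm_two_of_dominated (g := fun x => ‖gradient ψ x‖)
      (fun n => ((measurable_gradient _).sub (measurable_gradient _)).aestronglyMeasurable)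
      hg.norm (fun n => ?_) ?_
    · filter_upwards [hwg n] with x hx
      rw [hx, show ∀ (c : ℝ) (v : E N), c • v - v = (c - 1) • v from fun c v => by
        rw [sub_smul, one_smul], norm_smul, Real.norm_eq_abs, abs_sub_comm,
        abs_of_nonneg (sub_nonneg.2 (cutoff_le_one _ _))]
      exact mul_le_of_le_one_left (norm_nonneg _) (by linarith [cutoff_nonneg (ε n) (ψ x)])
    · filter_upwards [ae_all_iff.2 hwg, gradient_eq_zero_ae_of_eq_zero (by omega) hK]
        with x hx hx0
      by_cases h0 : ψ x = 0
      · simp [hx, hx0 h0]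
      · refine tendsto_const_nhds.congr' ?_
        have h2 : Tendsto (fun n => 2 * ε n) atTop (𝓝 0) := by simpa using hε0.const_mul 2
        filter_upwards [h2.eventually (gt_mem_nhds (abs_pos.2 h0))] with n hn
        rw [hx, cutoff_eq_one (hε n) hn.le, one_smul, sub_self]
  have hδ : ∀ n : ℕ, 0 < ENNReal.ofReal (ε n) := fun n => ENNReal.ofReal_pos.2 (hε n)
  choose u hu1 hu2 hu3 hu4 using fun n =>
    exists_testFunction_approx_of_hasCompactSupport (hwlip n) (hwc n) (hwb n) (hδ n)
  refine ⟨u, fun n => ⟨hu1 n, hu2 n, hu3 n⟩, ?_⟩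
  have h0 : Tendsto (fun n => ENNReal.ofReal (ε n) +
      eLpNorm (fun x => gradient (w n) x - gradient ψ x) 2 volume) atTop (𝓝 0) := by
    have := (ENNReal.tendsto_ofReal hε0).add hwlim
    simpa using this
  refine tendsto_of_tendsto_of_tendsto_of_le_of_le tendsto_const_nhds h0 (fun _ => zero_le)
    fun n => ?_
  calc eLpNorm (fun x => gradient (u n) x - gradient ψ x) 2 volume
      = eLpNorm ((fun x => gradient (u n) x - gradient (w n) x) +
          fun x => gradient (w n) x - gradient ψ x) 2 volume := by
        congr 1
        ext x : 1
        simp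
    _ ≤ _ := eLpNorm_add_le
        ((measurable_gradient _).sub (measurable_gradient _)).aestronglyMeasurable
        ((measurable_gradient _).sub (measurable_gradient _)).aestronglyMeasurable (by norm_num)
    _ ≤ _ := by gcongr; exact (hu4 n).le

/-! ### Radial symmetry of the solution -/

theorem pairing_comp_isometry (hN : 3 ≤ N) {ρ : E N → ℝ} (hρ : IsRadial ρ) {T : XDual N}
    (hT : T.IsGivenBy ρ) {ψ : E N → ℝ} (hψ : ψ ∈ X N) (τ : E N ≃ₗᵢ[ℝ] E N) :
    T.pairing (fun x => ψ (τ x)) (comp_isometry_mem_X hψ τ) = T.pairing ψ hψ := by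
  obtain ⟨u, hu, hlim⟩ := exists_testFunction_approx hN hψ
  have h1 := T.continuous_on_X u ψ (fun n => (hu n).1) hψ hlim
  have h2 := T.continuous_on_X (fun n x => u n (τ x)) (fun x => ψ (τ x))
    (fun n => comp_isometry_mem_X (hu n).1 τ) (comp_isometry_mem_X hψ τ) (by
      refine hlim.congr fun n => ?_
      have hm : AEStronglyMeasurable (fun x => gradient (u n) x - gradient ψ x) volume :=
        ((measurable_gradient _).sub (measurable_gradient _)).aestronglyMeasurable
      rw [← eLpNorm_comp_measurePreserving hm τ.measurePreserving]
      refine eLpNorm_congr_norm_ae (Eventually.of_forall fun x => ?_)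
      simp only [gradient_comp_isometry, ← map_sub, LinearIsometryEquiv.norm_map, Function.comp])
  refine tendsto_nhds_unique h2 (h1.congr fun n => ?_)
  have e1 := hT (u n) (hu n).1 (hu n).2.1 (hu n).2.2
  have e2 := hT (fun x => u n (τ x)) (comp_isometry_mem_X (hu n).1 τ)
    ((hu n).2.1.comp τ.contDiff) ((hu n).2.2.comp_homeomorph τ.toHomeomorph)
  change T.pairing (u n) (hu n).1 =
    T.pairing (fun x => u n (τ x)) (comp_isometry_mem_X (hu n).1 τ)
  rw [e1, e2, ← τ.measurePreserving.integral_comp τ.toHomeomorph.measurableEmbedding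
    (fun x => ρ x * u n x)]
  refine integral_congr_ae ?_
  filter_upwards [hρ τ] with x hx
  rw [hx]

/-- By Fubini, almost every line in the direction `y - x` meets the exceptional null set in a null
set. Along it `u` is absolutely continuous with zero derivative almost everywhere, hence constant;
continuity of `u` then covers every line. -/
theorem eq_of_gradient_ae_eq_zero {u : E N → ℝ} {K : NNReal} (hu : LipschitzWith K u)
    (h0 : ∀ᵐ x ∂(volume : Measure (E N)), gradient u x = 0) (x y : E N) : u x = u y := by
  set A : Set (E N) := {x | DifferentiableAt ℝ u x} ∩ {x | gradient u x = 0} with hA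
  have hAm : MeasurableSet A := (measurableSet_of_differentiableAt ℝ u).inter
    (measurable_gradient u (measurableSet_singleton 0))
  have hAae : ∀ᵐ x ∂(volume : Measure (E N)), x ∈ A := by
    filter_upwards [hu.ae_differentiableAt (μ := volume), h0] with x h1 h2 using ⟨h1, h2⟩
  set v := y - x with hv
  have hmeas : MeasurableSet {q : E N × ℝ | q.1 + q.2 • v ∈ A} :=
    hAm.preimage (by fun_prop)
  have hcomm : ∀ᵐ z ∂(volume : Measure (E N)), ∀ᵐ t : ℝ, z + t • v ∈ A := by
    rw [Measure.ae_ae_comm hmeas]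
    refine Eventually.of_forall fun t => ?_
    exact (measurePreserving_add_right volume (t • v)).quasiMeasurePreserving.ae hAae
  have hae : (fun z => u (z + v)) =ᵐ[volume] u := by
    filter_upwards [hcomm] with z hz
    have hlip : LipschitzWith (K * ‖v‖₊) fun t : ℝ => u (z + t • v) := by
      refine hu.comp (LipschitzWith.of_dist_le_mul fun s t => ?_)
      rw [dist_add_left, dist_eq_norm, ← sub_smul, norm_smul, dist_eq_norm, mul_comm]
      rfl
    obtain ⟨C, hC⟩ := (hlip.lipschitzOnWith (s := uIcc (0 : ℝ) 1)).absolutelyContinuousOnInterval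
      |>.const_of_ae_hasDerivAt_zero (by
        filter_upwards [hz] with t ht _
        have hd : HasFDerivAt u (fderiv ℝ u (z + t • v)) (z + t • v) := ht.1.hasFDerivAt
        have hfd : fderiv ℝ u (z + t • v) = 0 := by
          rw [← toDual_gradient, show gradient u (z + t • v) = 0 from ht.2, map_zero]
        rw [hfd] at hd
        have hl : HasDerivAt (fun t : ℝ => z + t • v) v t := by
          simpa using ((hasDerivAt_id t).smul_const v).const_add z
        have hc := hd.comp_hasDerivAt t hl
        rw [zero_apply] at hc
        exact hc)
    have h1 := hC 1 right_mem_uIcc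
    have h2 := hC 0 left_mem_uIcc
    simp only [one_smul, zero_smul, add_zero] at h1 h2
    rw [h1, h2]
  have heq := (Continuous.ae_eq_iff_eq volume (by have := hu.continuous; fun_prop)
    hu.continuous).1 hae
  have := congrFun heq x
  simp only [hv, add_sub_cancel] at this
  exact this.symm

/-- The strict reverse Cauchy-Schwarz inequality between unit timelike vectors. -/
theorem add_sq_norm_sub_le (p q : E N) :
    (1 - ‖p‖ ^ 2) * (1 - ‖q‖ ^ 2) + (1 - ‖p‖ ^ 2) * ‖p - q‖ ^ 2 ≤ (1 - inner ℝ p q) ^ 2 := by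
  have h := norm_sub_sq_real p q
  -- The two sides differ by exactly this square.
  nlinarith [sq_nonneg (‖p‖ ^ 2 - inner ℝ p q)]

theorem inner_lt_one {p q : E N} (hp : ‖p‖ < 1) (hq : ‖q‖ < 1) : inner ℝ p q < (1 : ℝ) :=
  (real_inner_le_norm p q).trans_lt (mul_lt_one_of_nonneg_of_lt_one_left (norm_nonneg _) hp hq.le)

theorem one_sub_sq_norm_pos {p : E N} (hp : ‖p‖ < 1) : 0 < 1 - ‖p‖ ^ 2 := by
  nlinarith [norm_nonneg p]

/-- The left side is the convexity excess `F(q) - F(p) - F'(p)(q - p)` of `F(p) = 1 - √(1 - |p|²)`.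
-/
theorem excess_eq {p : E N} (q : E N) (hp : ‖p‖ < 1) :
    inner ℝ p (p - q) / √(1 - ‖p‖ ^ 2) + (√(1 - ‖p‖ ^ 2) - √(1 - ‖q‖ ^ 2)) =
      (1 - inner ℝ p q) / √(1 - ‖p‖ ^ 2) - √(1 - ‖q‖ ^ 2) := by
  have hs := Real.sqrt_pos.2 (one_sub_sq_norm_pos hp)
  have hsq := Real.sq_sqrt (one_sub_sq_norm_pos hp).le
  rw [inner_sub_right, real_inner_self_eq_norm_sq]
  field_simp
  linarith

theorem excess_nonneg {p q : E N} (hp : ‖p‖ < 1) (hq : ‖q‖ < 1) :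
    0 ≤ inner ℝ p (p - q) / √(1 - ‖p‖ ^ 2) + (√(1 - ‖p‖ ^ 2) - √(1 - ‖q‖ ^ 2)) := by
  have hp' := one_sub_sq_norm_pos hp
  rw [excess_eq q hp, sub_nonneg, le_div_iff₀ (Real.sqrt_pos.2 hp'), mul_comm,
    ← Real.sqrt_mul hp'.le]
  refine Real.sqrt_le_iff.2 ⟨by linarith [inner_lt_one hp hq], ?_⟩
  have := add_sq_norm_sub_le p q
  have : 0 ≤ (1 - ‖p‖ ^ 2) * ‖p - q‖ ^ 2 := by positivity
  linarith

theorem eq_of_excess_eq_zero {p q : E N} (hp : ‖p‖ < 1) (hq : ‖q‖ < 1)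
    (h : inner ℝ p (p - q) / √(1 - ‖p‖ ^ 2) + (√(1 - ‖p‖ ^ 2) - √(1 - ‖q‖ ^ 2)) = 0) :
    p = q := by
  have hp' := one_sub_sq_norm_pos hp
  have hq' := one_sub_sq_norm_pos hq
  rw [excess_eq q hp, sub_eq_zero, div_eq_iff (Real.sqrt_pos.2 hp').ne'] at h
  have h2 := add_sq_norm_sub_le p q
  rw [h, mul_pow, Real.sq_sqrt hp'.le, Real.sq_sqrt hq'.le] at h2
  have h3 : ‖p - q‖ ^ 2 = 0 := le_antisymm (by nlinarith) (sq_nonneg _)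
  exact sub_eq_zero.1 (norm_eq_zero.1 (pow_eq_zero_iff two_ne_zero |>.1 h3))

theorem integrable_one_sub_sqrt {g : E N → E N} (hg : MemLp g 2 volume)
    (hb : ∀ᵐ x ∂(volume : Measure (E N)), ‖g x‖ < 1) :
    Integrable (fun x => 1 - √(1 - ‖g x‖ ^ 2)) volume := by
  refine Integrable.mono' (hg.integrable_norm_pow two_ne_zero) ?_ ?_
  · have hm := hg.aestronglyMeasurable.norm
    exact aestronglyMeasurable_const.sub
      (Real.continuous_sqrt.comp_aestronglyMeasurable (aestronglyMeasurable_const.sub (hm.pow 2)))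
  · filter_upwards [hb] with x hx
    have h1 := one_sub_sq_norm_pos hx
    have h2 : √(1 - ‖g x‖ ^ 2) ≤ 1 := Real.sqrt_le_one.2 (by nlinarith [sq_nonneg ‖g x‖])
    rw [Real.norm_of_nonneg (by linarith)]
    have := Real.sq_sqrt h1.le
    change 1 - √(1 - ‖g x‖ ^ 2) ≤ ‖g x‖ ^ 2
    nlinarith [Real.sqrt_nonneg (1 - ‖g x‖ ^ 2)]

theorem IsWeakSolution.comp_involution_eq (hN : 3 ≤ N) {ρ : E N → ℝ} (hρ : IsRadial ρ)
    {T : XDual N} (hT : T.IsGivenBy ρ) {φ : E N → ℝ} (hφ : IsWeakSolution T φ)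
    {τ : E N ≃ₗᵢ[ℝ] E N} (hτ : ∀ x, τ (τ x) = x) (x : E N) : φ (τ x) = φ x := by
  obtain ⟨hX, hlt, hweak⟩ := hφ
  have hX' := comp_isometry_mem_X hX τ
  have hψ := half_sub_mem_X hN hX hX'
  obtain ⟨hint, hval⟩ := hweak _ hψ
  -- The pairing is `τ`-invariant, while the half-difference changes sign under the involution `τ`.
  have hpair : T.pairing _ hψ = 0 := by
    have h1 := pairing_comp_isometry hN hρ hT hψ τ
    have h2 : T.pairing _ (comp_isometry_mem_X hψ τ) = - T.pairing _ hψ := by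
      unfold XDual.pairing
      rw [← map_neg]
      congr 1
      ext y
      simp only [hτ, Submodule.coe_neg, Pi.neg_apply]
      ring
    linarith
  rw [hpair] at hval
  obtain ⟨⟨K, hK⟩, ⟨-, hg, -⟩, -⟩ := id hX
  obtain ⟨⟨K', hK'⟩, -, -⟩ := id hX'
  obtain ⟨⟨L, hL⟩, -, -⟩ := id hψ
  have hgr := gradient_half_sub_ae hK hK'
  have hB := integrable_one_sub_sqrt hg hlt
  have hBτ : Integrable (fun x => 1 - √(1 - ‖gradient φ (τ x)‖ ^ 2)) volume :=
    τ.measurePreserving.integrable_comp_of_integrable hB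
  have hBint : ∫ x, (1 - √(1 - ‖gradient φ (τ x)‖ ^ 2)) = ∫ x, (1 - √(1 - ‖gradient φ x‖ ^ 2)) :=
    τ.measurePreserving.integral_comp τ.toHomeomorph.measurableEmbedding
      (fun x => 1 - √(1 - ‖gradient φ x‖ ^ 2))
  have hnorm : ∀ x, ‖gradient (fun y => φ (τ y)) x‖ = ‖gradient φ (τ x)‖ := fun x => by
    rw [gradient_comp_isometry, LinearIsometryEquiv.norm_map]
  -- `G` is the excess with `p = ∇φ` and `q = ∇(φ ∘ τ)`. The factor 2 undoes the 1/2, and the added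
  -- ones make each energy term integrable.
  set G : E N → ℝ := fun x => 2 * weakIntegrand φ (fun y => (1 / 2 : ℝ) * (φ y - φ (τ y))) x +
    ((1 - √(1 - ‖gradient φ (τ x)‖ ^ 2)) - (1 - √(1 - ‖gradient φ x‖ ^ 2))) with hG
  have hGint : Integrable G volume := (hint.const_mul 2).add (hBτ.sub hB)
  have hG0 : ∫ x, G x = 0 := by
    have h := integral_add (hint.const_mul 2) (hBτ.sub hB)
    rw [integral_const_mul, hval, integral_sub' hBτ hB, hBint, sub_self, mul_zero, add_zero] at h
    exact h
  have hGeq : ∀ᵐ x ∂(volume : Measure (E N)), G x =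
      inner ℝ (gradient φ x) (gradient φ x - gradient (fun y => φ (τ y)) x) /
        √(1 - ‖gradient φ x‖ ^ 2) +
      (√(1 - ‖gradient φ x‖ ^ 2) - √(1 - ‖gradient (fun y => φ (τ y)) x‖ ^ 2)) := by
    filter_upwards [hgr] with x hx
    rw [hG]
    simp only [weakIntegrand]
    rw [hx, inner_smul_right, hnorm]
    ring
  have hlt' : ∀ᵐ x ∂(volume : Measure (E N)), ‖gradient (fun y => φ (τ y)) x‖ < 1 := by
    simp_rw [hnorm]
    exact τ.measurePreserving.quasiMeasurePreserving.ae hlt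
  have hGae : G =ᵐ[volume] 0 := by
    refine (integral_eq_zero_iff_of_nonneg_ae ?_ hGint).1 hG0
    filter_upwards [hGeq, hlt, hlt'] with x h1 h2 h3
    rw [h1]
    exact excess_nonneg h2 h3
  have hzero : ∀ᵐ x ∂(volume : Measure (E N)),
      gradient (fun y => (1 / 2 : ℝ) * (φ y - φ (τ y))) x = 0 := by
    filter_upwards [hGeq, hlt, hlt', hGae, hgr] with x h1 h2 h3 h4 h5
    rw [h4] at h1
    rw [h5, ← eq_of_excess_eq_zero h2 h3 h1.symm, sub_self, smul_zero]
  -- The difference is constant, and zero at the origin, which `τ` fixes.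
  have := eq_of_gradient_ae_eq_zero hL hzero x 0
  simp only [map_zero, sub_self, mul_zero] at this
  linarith

theorem IsWeakSolution.eq_of_norm_eq (hN : 3 ≤ N) {ρ : E N → ℝ} (hρ : IsRadial ρ)
    {T : XDual N} (hT : T.IsGivenBy ρ) {φ : E N → ℝ} (hφ : IsWeakSolution T φ) {x y : E N}
    (h : ‖x‖ = ‖y‖) : φ x = φ y := by
  have := hφ.comp_involution_eq hN hρ hT
    (τ := (Submodule.span ℝ {x - y})ᗮ.reflection) (Submodule.reflection_reflection _) x
  rw [Submodule.reflection_sub h] at this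
  exact this.symm

/-! ### Arbitrary test functions and radial calculus -/

theorem IsWeakSolution.integral_testFunction {ρ : E N → ℝ} {T : XDual N} (hT : T.IsGivenBy ρ)
    {φ : E N → ℝ} (hφ : IsWeakSolution T φ) {u : E N → ℝ} (hu : ContDiff ℝ ∞ u)
    (hc : HasCompactSupport u) :
    Integrable (weakIntegrand φ u) volume ∧ ∫ x, weakIntegrand φ u x = ∫ x, ρ x * u x := by
  obtain ⟨C, hC⟩ := (hc.fderiv ℝ).exists_bound_of_continuous (hu.continuous_fderiv (by simp))
  -- Scaling by `c` brings the gradient into the unit ball; the maximum with 1 covers `C ≤ 0`.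
  set c : ℝ := (max C 1)⁻¹ with hc_def
  have hpos : 0 < max C 1 := lt_max_of_lt_right one_pos
  have hc0 : c ≠ 0 := (inv_pos.2 hpos).ne'
  have hgrad : ∀ x, gradient (fun y => c * u y) x = c • gradient u x := fun x => by
    refine HasGradientAt.gradient ?_
    rw [hasGradientAt_iff_hasFDerivAt, map_smul, toDual_gradient]
    exact (hu.differentiable (by simp) x).hasFDerivAt.const_mul c
  have hX : (fun y => c * u y) ∈ X N := by
    refine testFunction_mem_X (contDiff_const.mul hu) hc.mul_left fun x => ?_
    have h1 : ‖gradient u x‖ = ‖fderiv ℝ u x‖ := by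
      rw [← toDual_gradient, LinearIsometryEquiv.norm_map]
    rw [hgrad, norm_smul, h1, Real.norm_of_nonneg (inv_pos.2 hpos).le, inv_mul_le_iff₀ hpos,
      mul_one]
    exact (hC x).trans (le_max_left _ _)
  have hw : weakIntegrand φ (fun y => c * u y) = fun x => c * weakIntegrand φ u x := by
    ext x
    simp only [weakIntegrand, hgrad, inner_smul_right]
    ring
  obtain ⟨h1, h2⟩ := hφ.2.2 _ hX
  rw [hT _ hX (contDiff_const.mul hu) hc.mul_left, hw, integral_const_mul] at h2
  rw [hw] at h1
  refine ⟨by simpa [hc0] using h1.const_mul c⁻¹, mul_left_cancel₀ hc0 (h2.trans ?_)⟩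
  rw [← integral_const_mul]
  congr 1
  ext x
  ring

theorem hasGradientAt_norm {x : E N} (hx : x ≠ 0) :
    HasGradientAt (fun y : E N => ‖y‖) (‖x‖⁻¹ • x) x := by
  rw [hasGradientAt_iff_hasFDerivAt]
  have h := ((hasStrictFDerivAt_norm_sq x).hasFDerivAt).sqrt (pow_ne_zero 2 (norm_ne_zero_iff.2 hx))
  have hfun : (fun y : E N => √(‖y‖ ^ 2)) = fun y => ‖y‖ := by
    ext y
    exact Real.sqrt_sq (norm_nonneg y)
  rw [hfun] at h
  refine h.congr_fderiv ?_
  ext v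
  have := norm_ne_zero_iff.2 hx
  simp [Real.sqrt_sq (norm_nonneg x)]
  field_simp

theorem hasGradientAt_comp_norm {f : ℝ → ℝ} {d : ℝ} {x : E N} (hx : x ≠ 0)
    (hf : HasDerivAt f d ‖x‖) : HasGradientAt (fun y => f ‖y‖) (d • ‖x‖⁻¹ • x) x := by
  rw [hasGradientAt_iff_hasFDerivAt, map_smul]
  exact hf.comp_hasFDerivAt x (hasGradientAt_norm hx).hasFDerivAt

theorem inner_radial (a b : ℝ) {x : E N} (hx : x ≠ 0) :
    inner ℝ (a • ‖x‖⁻¹ • x) (b • ‖x‖⁻¹ • x) = a * b := by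
  have := norm_ne_zero_iff.2 hx
  rw [inner_smul_left, inner_smul_right, inner_smul_left, inner_smul_right,
    real_inner_self_eq_norm_sq]
  simp only [conj_trivial]
  field_simp

theorem norm_radial (a : ℝ) {x : E N} (hx : x ≠ 0) : ‖a • ‖x‖⁻¹ • x‖ = |a| := by
  rw [norm_smul, norm_smul, norm_inv, norm_norm, inv_mul_cancel₀ (norm_ne_zero_iff.2 hx), mul_one,
    Real.norm_eq_abs]

theorem gradient_radial {φ : E N → ℝ} {f : ℝ → ℝ} (hf : ∀ x, φ x = f ‖x‖) {x : E N} (hx : x ≠ 0)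
    (hd : DifferentiableAt ℝ φ x) : gradient φ x = deriv f ‖x‖ • ‖x‖⁻¹ • x := by
  have hpos := norm_pos_iff.2 hx
  have hfd : DifferentiableAt ℝ f ‖x‖ := by
    have h1 : ‖x‖ • ‖x‖⁻¹ • x = x := smul_inv_smul₀ hpos.ne' x
    have h2 : DifferentiableAt ℝ (fun s : ℝ => φ (s • ‖x‖⁻¹ • x)) ‖x‖ :=
      DifferentiableAt.comp ‖x‖ (by rwa [h1]) (by fun_prop)
    refine h2.congr_of_eventuallyEq ?_
    filter_upwards [lt_mem_nhds hpos] with s hs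
    rw [hf, norm_smul, norm_smul, norm_inv, norm_norm, inv_mul_cancel₀ hpos.ne', mul_one,
      Real.norm_of_nonneg hs.le]
  rw [show φ = fun y => f ‖y‖ from funext hf]
  exact (hasGradientAt_comp_norm hx hfd.hasDerivAt).gradient

theorem ae_ne_zero (hN : 0 < N) : ∀ᵐ x ∂(volume : Measure (E N)), x ≠ 0 := by
  have : Nonempty (Fin N) := ⟨⟨0, hN⟩⟩
  exact Measure.ae_ne volume 0

/-- Polar coordinates for the indicator of the exceptional set, whose weight `r^(N-1)` is positive.
The indicator is integrable because it vanishes almost everywhere, so `p` need not be measurable. -/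
theorem ae_of_ae_norm (hN : 0 < N) {p : ℝ → Prop}
    (h : ∀ᵐ x ∂(volume : Measure (E N)), p ‖x‖) : ∀ᵐ r : ℝ, 0 < r → p r := by
  have : Nonempty (Fin N) := ⟨⟨0, hN⟩⟩
  set χ : ℝ → ℝ := {r | p r}ᶜ.indicator fun _ => 1 with hχ
  have h0 : (fun x : E N => χ ‖x‖) =ᵐ[volume] 0 := by
    filter_upwards [h] with x hx
    exact indicator_of_notMem (by simpa using hx) _
  have hint : Integrable (fun x : E N => χ ‖x‖) volume := (integrable_zero _ _ _).congr h0.symm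
  have h1 := (integrable_fun_norm_addHaar (volume : Measure (E N))).1 hint
  have h2 := integral_fun_norm_addHaar (volume : Measure (E N)) χ
  rw [integral_congr_ae h0] at h2
  simp only [Pi.zero_apply, integral_zero, finrank_euclideanSpace_fin, nsmul_eq_mul,
    smul_eq_mul] at h2 h1
  have hc : (volume : Measure (E N)).real (Metric.ball 0 1) ≠ 0 :=
    ENNReal.toReal_ne_zero.2 ⟨(Metric.measure_ball_pos _ _ one_pos).ne', measure_ball_lt_top.ne⟩
  have hN' : (N : ℝ) ≠ 0 := by exact_mod_cast hN.ne'
  have h3 : ∫ y in Ioi (0 : ℝ), y ^ (N - 1) * χ y = 0 := by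
    simpa [hc, hN'] using h2.symm
  have h4 := (setIntegral_eq_zero_iff_of_nonneg_ae ?_ h1).1 h3
  · rw [EventuallyEq, ae_restrict_iff' measurableSet_Ioi] at h4
    filter_upwards [h4] with r hr hr0
    by_contra hpr
    have := hr hr0
    rw [hχ, indicator_of_mem (show r ∈ {r | p r}ᶜ from hpr)] at this
    simp [hr0.ne'] at this
  · rw [EventuallyLE, ae_restrict_iff' measurableSet_Ioi]
    refine Eventually.of_forall fun r hr => ?_
    exact mul_nonneg (pow_nonneg (le_of_lt hr) _)
      (indicator_nonneg (fun _ _ => zero_le_one) _)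

/-! ### The radial flux equation -/

/-- This makes every `g` in `C_c^∞(0, ∞)` the radial derivative of a test function. The primitive
`χ` is constant near 0, which removes the singularity of `|x|` there. -/
theorem exists_radial_potential {g : ℝ → ℝ} (hg : ContDiff ℝ ∞ g) (hc : HasCompactSupport g)
    (hs : tsupport g ⊆ Ioi 0) :
    ∃ (b : ℝ) (χ : ℝ → ℝ), 0 < b ∧ (∀ r, b ≤ r → g r = 0) ∧ (∀ r, HasDerivAt χ (g r) r) ∧
      (∀ r, χ r = -∫ s in Ioi r, g s) ∧
      ContDiff ℝ ∞ (fun x : E N => χ ‖x‖) ∧ HasCompactSupport (fun x : E N => χ ‖x‖) := by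
  have hgc := hg.continuous
  have hgi : Integrable g volume := hgc.integrable_of_hasCompactSupport hc
  obtain ⟨b, hb0, hb⟩ : ∃ b : ℝ, 0 < b ∧ ∀ r, b ≤ r → g r = 0 := by
    obtain ⟨R, hR⟩ := hc.isCompact.isBounded.subset_closedBall (0 : ℝ)
    refine ⟨max R 0 + 1, by positivity, fun r hr => image_eq_zero_of_notMem_tsupport fun h => ?_⟩
    have := hR h
    rw [mem_closedBall_zero_iff, Real.norm_eq_abs] at this
    linarith [le_abs_self r, le_max_left R 0]
  set χ : ℝ → ℝ := fun r => ∫ s in b..r, g s with hχ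
  have hder : ∀ r, HasDerivAt χ (g r) r := fun r =>
    intervalIntegral.integral_hasDerivAt_right (hgc.intervalIntegrable _ _)
      hgc.aestronglyMeasurable.stronglyMeasurableAtFilter hgc.continuousAt
  have htail : ∀ r, b ≤ r → ∫ s in Ioi r, g s = 0 := fun r hr =>
    setIntegral_eq_zero_of_forall_eq_zero fun s hs => hb s (hr.trans (le_of_lt hs))
  have hχeq : ∀ r, χ r = -∫ s in Ioi r, g s := fun r => by
    have h := intervalIntegral.integral_Ioi_sub_Ioi' hgi.integrableOn
      (hgi.integrableOn (s := Ioi b)) (a := r)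
    rw [htail b le_rfl, sub_zero] at h
    rw [h, hχ, ← intervalIntegral.integral_symm]
  have hsm : ContDiff ℝ ∞ χ := by
    rw [contDiff_infty_iff_deriv]
    refine ⟨fun r => (hder r).differentiableAt, ?_⟩
    rwa [show deriv χ = g from funext fun r => (hder r).deriv]
  have hnear : ∀ᶠ r in 𝓝 (0 : ℝ), g r = 0 := by
    have h0 : (0 : ℝ) ∉ tsupport g := fun h => lt_irrefl (0 : ℝ) (hs h)
    exact notMem_tsupport_iff_eventuallyEq.1 h0
  obtain ⟨ε, hε, hball⟩ := Metric.eventually_nhds_iff.1 hnear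
  have hconst : ∀ x : E N, ‖x‖ < ε → χ ‖x‖ = χ 0 := fun x hx => by
    have h : ∫ s in (0 : ℝ)..‖x‖, g s = 0 := by
      refine (intervalIntegral.integral_congr (g := fun _ => (0 : ℝ)) fun s hs => ?_).trans
        (by simp)
      rw [uIcc_of_le (norm_nonneg x)] at hs
      refine hball ?_
      rw [Real.dist_0_eq_abs, abs_of_nonneg hs.1]
      exact hs.2.trans_lt hx
    have h2 := intervalIntegral.integral_add_adjacent_intervals (μ := volume)
      (hgc.intervalIntegrable b 0) (hgc.intervalIntegrable 0 ‖x‖)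
    rw [h, add_zero] at h2
    exact h2.symm
  refine ⟨b, χ, hb0, hb, hder, hχeq, contDiff_iff_contDiffAt.2 fun x => ?_, ?_⟩
  · by_cases hx : x = 0
    · subst hx
      refine (contDiffAt_const (c := χ 0)).congr_of_eventuallyEq ?_
      filter_upwards [Metric.ball_mem_nhds (0 : E N) hε] with y hy
      exact hconst y (mem_ball_zero_iff.1 hy)
    · exact hsm.contDiffAt.comp x (contDiffAt_norm ℝ hx)
  · refine HasCompactSupport.intro (isCompact_closedBall (0 : E N) b) fun x hx => ?_
    rw [mem_closedBall_zero_iff, not_le] at hx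
    rw [hχeq, htail _ hx.le, neg_zero]

/-- The integral of `ρ` over the ball of radius `r`. -/
noncomputable def ballMass (ρ : E N → ℝ) (r : ℝ) : ℝ := ∫ x in Metric.ball 0 r, ρ x

theorem integral_mul_radial_potential {ρ : E N → ℝ} (hρ : LocallyIntegrable ρ volume)
    {g χ : ℝ → ℝ} {b : ℝ} (hg : Integrable g volume) (hb : ∀ r, b ≤ r → g r = 0)
    (hχ : ∀ r, χ r = -∫ s in Ioi r, g s) :
    ∫ x, ρ x * χ ‖x‖ = -∫ r in Ioi (0 : ℝ), g r * ballMass ρ r := by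
  set F : E N → ℝ → ℝ := fun x r => {q : E N × ℝ | ‖q.1‖ < q.2}.indicator
    (fun q => ρ q.1 * g q.2) (x, r) with hF
  have hm : MeasurableSet {q : E N × ℝ | ‖q.1‖ < q.2} :=
    (isOpen_lt (by fun_prop) (by fun_prop)).measurableSet
  have hρb : Integrable ((Metric.ball (0 : E N) b).indicator ρ) volume := by
    rw [integrable_indicator_iff Metric.isOpen_ball.measurableSet]
    exact (hρ.integrableOn_isCompact (isCompact_closedBall 0 b)).mono_set Metric.ball_subset_closedBall
  -- If `|x| < r` and `g r ≠ 0` then `|x| < b`, so only the integrable restriction of `ρ` to a ball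
  -- matters and Fubini applies.
  have hFeq : ∀ x r, F x r = {q : E N × ℝ | ‖q.1‖ < q.2}.indicator
      (fun q => (Metric.ball (0 : E N) b).indicator ρ q.1 * g q.2) (x, r) := fun x r => by
    simp only [hF, indicator, mem_ofPred_eq, mem_ball_zero_iff]
    by_cases h1 : ‖x‖ < r
    · by_cases h2 : ‖x‖ < b
      · simp [h1, h2]
      · simp [h1, h2, hb r ((not_lt.1 h2).trans h1.le)]
    · simp [h1]
  have hint : Integrable (Function.uncurry F) (volume.prod volume) := by
    have := (hρb.mul_prod hg).indicator hm
    refine this.congr (Eventually.of_forall fun q => ?_)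
    exact (hFeq q.1 q.2).symm
  have h1 : ∀ x, ∫ r, F x r = -(ρ x * χ ‖x‖) := fun x => by
    have : (fun r => F x r) = (Ioi ‖x‖).indicator fun r => ρ x * g r := by
      ext r
      simp [hF, indicator]
    rw [this, integral_indicator measurableSet_Ioi, integral_const_mul, hχ]
    ring
  have h2 : ∀ r, ∫ x, F x r = g r * ballMass ρ r := fun r => by
    have : (fun x => F x r) = (Metric.ball (0 : E N) r).indicator fun x => ρ x * g r := by
      ext x
      simp [hF, indicator]
    rw [this, integral_indicator Metric.isOpen_ball.measurableSet, integral_mul_const, ballMass,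
      mul_comm]
  have h3 := integral_integral_swap hint
  simp_rw [h1, h2] at h3
  rw [integral_neg] at h3
  rw [← neg_eq_iff_eq_neg, h3, eq_comm]
  refine setIntegral_eq_integral_of_forall_compl_eq_zero fun r hr => ?_
  rw [ballMass, Metric.ball_eq_empty.2 (not_lt.1 hr)]
  simp

theorem continuous_ballMass (hN : 0 < N) {ρ : E N → ℝ} (hρ : LocallyIntegrable ρ volume) :
    Continuous (ballMass ρ) := by
  have : Nonempty (Fin N) := ⟨⟨0, hN⟩⟩
  refine continuous_iff_continuousAt.2 fun r => ?_
  have heq : ballMass ρ = fun s => ∫ x, (Metric.ball (0 : E N) s).indicator ρ x := by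
    ext s
    rw [integral_indicator Metric.isOpen_ball.measurableSet, ballMass]
  rw [heq]
  have hb : IntegrableOn ρ (Metric.closedBall (0 : E N) (r + 1)) volume :=
    hρ.integrableOn_isCompact (isCompact_closedBall 0 (r + 1))
  refine tendsto_integral_filter_of_dominated_convergence
    ((Metric.closedBall (0 : E N) (r + 1)).indicator fun x => ‖ρ x‖) ?_ ?_ ?_ ?_
  · exact Eventually.of_forall fun s =>
      hρ.aestronglyMeasurable.indicator Metric.isOpen_ball.measurableSet
  · filter_upwards [gt_mem_nhds (lt_add_one r)] with s hs
    refine Eventually.of_forall fun x => ?_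
    rw [norm_indicator_eq_indicator_norm]
    exact indicator_le_indicator_of_subset
      (Metric.ball_subset_closedBall.trans (Metric.closedBall_subset_closedBall hs.le))
      (fun _ => norm_nonneg _) x
  · rw [integrable_indicator_iff Metric.isClosed_closedBall.measurableSet]
    exact hb.norm
  · have hsph : ∀ᵐ x ∂(volume : Measure (E N)), x ∉ Metric.sphere (0 : E N) r :=
      measure_eq_zero_iff_ae_notMem.1 (Measure.addHaar_sphere volume 0 r)
    filter_upwards [hsph] with x hx
    rw [mem_sphere_zero_iff_norm] at hx
    refine tendsto_const_nhds.congr' ?_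
    rcases lt_or_gt_of_ne hx with h | h
    · filter_upwards [lt_mem_nhds h] with s hs
      rw [indicator_of_mem (by simpa using h), indicator_of_mem (by simpa using hs)]
    · filter_upwards [gt_mem_nhds h] with s hs
      rw [indicator_of_notMem (by simpa using h.le), indicator_of_notMem (by simpa using hs.le)]

/-- The constant `N |B₁|`, the area of the unit sphere. -/
noncomputable def sphereArea (N : ℕ) : ℝ := N * (volume : Measure (E N)).real (Metric.ball 0 1)

theorem sphereArea_pos (hN : 0 < N) : 0 < sphereArea N :=
  mul_pos (by exact_mod_cast hN)
    (ENNReal.toReal_pos (Metric.measure_ball_pos _ _ one_pos).ne' measure_ball_lt_top.ne)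

/-- The energy controls only `t² / √(1 - t²)`; this bound makes the flux itself locally integrable
away from the origin. For `|t| > 1/2` one has `|t| ≤ 2t²`, and otherwise the quotient is at most 1.
-/
theorem abs_div_sqrt_le (t : ℝ) : |t / √(1 - t ^ 2)| ≤ 1 + 2 * (t * t / √(1 - t ^ 2)) := by
  rcases le_or_gt (1 - t ^ 2) 0 with h | h
  -- Here the root is 0, and division by zero gives 0 on both sides.
  · simp [Real.sqrt_eq_zero_of_nonpos h]
  have hs := Real.sqrt_pos.2 h
  have hsq := Real.sq_sqrt h.le
  rw [abs_div, abs_of_pos hs, mul_div_assoc', ← sub_le_iff_le_add, ← sub_div,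
    div_le_one hs, ← abs_mul_abs_self t]
  have h0 := abs_nonneg t
  rw [← sq_abs] at h
  have h1 : |t| < 1 := by nlinarith
  rcases le_or_gt (1 / 2) |t| with h2 | h2
  · nlinarith
  · have h3 : |t| ≤ √(1 - t ^ 2) := Real.le_sqrt_of_sq_le (by rw [← sq_abs t]; nlinarith)
    nlinarith

theorem weakIntegrand_radial_ae (hN : 0 < N) {φ u : E N → ℝ} {f h : ℝ → ℝ} {K : NNReal}
    (hφ : LipschitzWith K φ) (hf : ∀ x, φ x = f ‖x‖)
    (hu : ∀ᵐ x ∂(volume : Measure (E N)), gradient u x = h ‖x‖ • ‖x‖⁻¹ • x) :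
    (fun x : E N => deriv f ‖x‖ * h ‖x‖ / √(1 - deriv f ‖x‖ ^ 2)) =ᵐ[volume]
      weakIntegrand φ u := by
  filter_upwards [hφ.ae_differentiableAt (μ := volume), ae_ne_zero hN, hu] with x hd hx hux
  rw [weakIntegrand, gradient_radial hf hx hd, hux, inner_radial _ _ hx, norm_radial _ hx, sq_abs]

theorem IsWeakSolution.flux_eq (hN : 0 < N) {ρ : E N → ℝ} (hρ : LocallyIntegrable ρ volume)
    {T : XDual N} (hT : T.IsGivenBy ρ) {φ : E N → ℝ} (hφ : IsWeakSolution T φ)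
    {f : ℝ → ℝ} (hf : ∀ x, φ x = f ‖x‖) :
    ∀ᵐ r : ℝ, 0 < r → sphereArea N * r ^ (N - 1) * (deriv f r / √(1 - deriv f r ^ 2)) +
      ballMass ρ r = 0 := by
  have : Nonempty (Fin N) := ⟨⟨0, hN⟩⟩
  obtain ⟨⟨K, hK⟩, -, -⟩ := id hφ.1
  have hgrad : ∀ᵐ x ∂(volume : Measure (E N)), gradient φ x = deriv f ‖x‖ • ‖x‖⁻¹ • x := by
    filter_upwards [hK.ae_differentiableAt (μ := volume), ae_ne_zero hN] with x hd hx
    exact gradient_radial hf hx hd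
  have hM := continuous_ballMass hN hρ
  set w : ℝ → ℝ := fun r => deriv f r / √(1 - deriv f r ^ 2) with hw
  have hwm : Measurable w :=
    (measurable_deriv f).div
      (Real.continuous_sqrt.measurable.comp (measurable_const.sub ((measurable_deriv f).pow_const 2)))
  -- This comes from testing the equation with `φ` itself.
  have henergy : IntegrableOn
      (fun r : ℝ => r ^ (N - 1) * (deriv f r * deriv f r / √(1 - deriv f r ^ 2))) (Ioi 0) := by
    have h1 := ((hφ.2.2 φ hφ.1).1).congr (weakIntegrand_radial_ae hN hK hf hgrad).symm
    have h2 := (integrable_fun_norm_addHaar (volume : Measure (E N))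
      (f := fun r => deriv f r * deriv f r / √(1 - deriv f r ^ 2))).1 h1
    simpa only [finrank_euclideanSpace_fin, smul_eq_mul] using h2
  have hloc : ∀ k ⊆ Ioi (0 : ℝ), IsCompact k →
      IntegrableOn (fun r => sphereArea N * r ^ (N - 1) * w r) k := by
    intro k hk hkc
    have h1 : IntegrableOn (fun r : ℝ => r ^ (N - 1) * w r) k := by
      refine Integrable.mono' (g := fun r : ℝ => r ^ (N - 1) +
        2 * (r ^ (N - 1) * (deriv f r * deriv f r / √(1 - deriv f r ^ 2)))) ?_
        ((measurable_id.pow_const _).mul hwm).aestronglyMeasurable ?_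
      · exact ((continuous_pow (N - 1)).continuousOn.integrableOn_compact hkc).add
          ((henergy.mono_set hk).const_mul 2)
      · rw [ae_restrict_iff' hkc.measurableSet]
        refine Eventually.of_forall fun r hr => ?_
        have hr0 : 0 ≤ r ^ (N - 1) := pow_nonneg (le_of_lt (hk hr)) _
        rw [norm_mul, Real.norm_of_nonneg hr0, Real.norm_eq_abs]
        calc r ^ (N - 1) * |w r|
            ≤ r ^ (N - 1) * (1 + 2 * (deriv f r * deriv f r / √(1 - deriv f r ^ 2))) := by
              gcongr
              exact abs_div_sqrt_le _
          _ = _ := by ring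
    simp only [mul_assoc]
    exact h1.const_mul (sphereArea N)
  refine isOpen_Ioi.ae_eq_zero_of_integral_contDiff_smul_eq_zero ?_ fun g hg hgc hgs => ?_
  · rw [locallyIntegrableOn_iff isOpen_Ioi.isLocallyClosed]
    exact fun k hk hkc => (hloc k hk hkc).add (hM.continuousOn.integrableOn_compact hkc)
  · obtain ⟨b, χ, -, hb, hder, hχ, hsm, hcs⟩ := exists_radial_potential (N := N) hg hgc hgs
    have hu : ∀ᵐ x ∂(volume : Measure (E N)),
        gradient (fun y : E N => χ ‖y‖) x = g ‖x‖ • ‖x‖⁻¹ • x := by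
      filter_upwards [ae_ne_zero hN] with x hx
      exact (hasGradientAt_comp_norm hx (hder ‖x‖)).gradient
    have hrad := weakIntegrand_radial_ae hN hK hf hu
    obtain ⟨h1, h2⟩ := hφ.integral_testFunction hT hsm hcs
    have h3 := (integrable_fun_norm_addHaar (volume : Measure (E N))
      (f := fun r => deriv f r * g r / √(1 - deriv f r ^ 2))).1 (h1.congr hrad.symm)
    have h4 := integral_fun_norm_addHaar (volume : Measure (E N))
      (fun r => deriv f r * g r / √(1 - deriv f r ^ 2))
    rw [integral_congr_ae hrad, h2, integral_mul_radial_potential hρ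
      (hg.continuous.integrable_of_hasCompactSupport hgc) hb hχ] at h4
    simp only [finrank_euclideanSpace_fin, nsmul_eq_mul, smul_eq_mul] at h3 h4
    rw [← mul_assoc, ← sphereArea, ← integral_const_mul] at h4
    have h5 : IntegrableOn (fun r => g r * ballMass ρ r) (Ioi 0) :=
      (Continuous.integrable_of_hasCompactSupport (hg.continuous.mul hM) hgc.mul_right).integrableOn
    have h6 := integral_add (h3.const_mul (sphereArea N)) h5
    rw [← h4, neg_add_cancel] at h6
    rw [← setIntegral_eq_integral_of_forall_compl_eq_zero (s := Ioi (0 : ℝ))]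
    · refine Eq.trans (integral_congr_ae (Eventually.of_forall fun r => ?_)) h6
      simp only [smul_eq_mul]
      ring
    · intro r hr
      rw [image_eq_zero_of_notMem_tsupport fun h => hr (hgs h), zero_smul]

/-! ### Regularity away from the origin -/

/-- The slope `-Q / √(1 + Q²)`, where `Q r` is the mean flux through the sphere of radius `r`. -/
noncomputable def slope (ρ : E N → ℝ) (r : ℝ) : ℝ :=
  -(ballMass ρ r / (sphereArea N * r ^ (N - 1))) /
    √(1 + (ballMass ρ r / (sphereArea N * r ^ (N - 1))) ^ 2)

theorem eq_of_div_sqrt_eq {t q : ℝ} (ht : |t| < 1) (h : t / √(1 - t ^ 2) = -q) :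
    t = -q / √(1 + q ^ 2) := by
  have h1 : 0 < 1 - t ^ 2 := by
    rw [← sq_abs]
    nlinarith [abs_nonneg t]
  have hs := Real.sqrt_pos.2 h1
  -- Squaring the hypothesis gives `1 + q² = 1 / (1 - t²)`.
  have hq : 1 + q ^ 2 = (√(1 - t ^ 2))⁻¹ ^ 2 := by
    rw [← neg_sq q, ← h, div_pow, inv_pow, Real.sq_sqrt h1.le]
    field_simp
    ring
  rw [hq, Real.sqrt_sq (inv_pos.2 hs).le, ← h]
  field_simp

theorem abs_neg_div_sqrt_lt_one (q : ℝ) : |-q / √(1 + q ^ 2)| < 1 := by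
  have hs : 0 < √(1 + q ^ 2) := Real.sqrt_pos.2 (by positivity)
  rw [abs_div, abs_neg, abs_of_pos hs, div_lt_one hs]
  refine Real.lt_sqrt_of_sq_lt ?_
  rw [sq_abs]
  linarith

theorem continuousOn_slope (hN : 0 < N) {ρ : E N → ℝ} (hρ : LocallyIntegrable ρ volume) :
    ContinuousOn (slope ρ) (Ioi 0) := by
  have hQ : ContinuousOn (fun r => ballMass ρ r / (sphereArea N * r ^ (N - 1))) (Ioi 0) :=
    (continuous_ballMass hN hρ).continuousOn.div (by fun_prop) fun r hr =>
      (mul_pos (sphereArea_pos hN) (pow_pos hr _)).ne'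
  exact hQ.neg.div (Real.continuous_sqrt.comp_continuousOn (continuousOn_const.add (hQ.pow 2)))
    fun r _ => (Real.sqrt_pos.2 (by positivity)).ne'

theorem IsWeakSolution.deriv_ae_eq_slope (hN : 0 < N) {ρ : E N → ℝ}
    (hρ : LocallyIntegrable ρ volume) {T : XDual N} (hT : T.IsGivenBy ρ) {φ : E N → ℝ}
    (hφ : IsWeakSolution T φ) {f : ℝ → ℝ} (hf : ∀ x, φ x = f ‖x‖) :
    ∀ᵐ r : ℝ, 0 < r → deriv f r = slope ρ r := by
  obtain ⟨⟨K, hK⟩, -, -⟩ := id hφ.1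
  have hlt : ∀ᵐ r : ℝ, 0 < r → |deriv f r| < 1 := by
    refine ae_of_ae_norm (N := N) (p := fun r => |deriv f r| < 1) hN ?_
    filter_upwards [hK.ae_differentiableAt (μ := volume), ae_ne_zero hN, hφ.2.1] with x hd hx hlt
    rwa [gradient_radial hf hx hd, norm_radial _ hx] at hlt
  filter_upwards [hlt, hφ.flux_eq hN hρ hT hf] with r h1 h2 hr
  refine eq_of_div_sqrt_eq (h1 hr) ?_
  have hc := mul_pos (sphereArea_pos hN) (pow_pos hr (N - 1))
  rw [← neg_div, eq_div_iff hc.ne']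
  linarith [h2 hr]

/-- A Lipschitz function is the integral of its derivative, which may be replaced by the continuous
`P` before differentiating. -/
theorem hasDerivAt_of_deriv_ae_eq {f P : ℝ → ℝ} {K : NNReal} (hf : LipschitzWith K f)
    (hP : ContinuousOn P (Ioi 0)) (h : ∀ᵐ r : ℝ, 0 < r → deriv f r = P r) {r : ℝ} (hr : 0 < r) :
    HasDerivAt f (P r) r := by
  have hsub : ∀ s, 0 < s → uIcc r s ⊆ Ioi 0 := fun s hs t ht =>
    (lt_min hr hs).trans_le ht.1
  have hd : HasDerivAt (fun s => ∫ t in r..s, P t) (P r) r :=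
    intervalIntegral.integral_hasDerivAt_right (by simp)
      (hP.stronglyMeasurableAtFilter isOpen_Ioi r hr) (hP.continuousAt (Ioi_mem_nhds hr))
  refine (hd.const_add (f r)).congr_of_eventuallyEq ?_
  filter_upwards [Ioi_mem_nhds hr] with s hs
  have h1 := (hf.lipschitzOnWith (s := uIcc r s)).absolutelyContinuousOnInterval.integral_deriv_eq_sub
  have h2 : ∫ t in r..s, deriv f t = ∫ t in r..s, P t := by
    refine intervalIntegral.integral_congr_ae ?_
    filter_upwards [h] with t ht hts
    exact ht (hsub s hs (uIoc_subset_uIcc hts))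
  rw [← h2, h1]
  ring

/-! ### Behaviour at the origin -/

/-- Hölder's inequality bounds the mass by `‖ρ‖_{L^N(B_r)} |B_r|^(1 - 1/N)`, and the last factor is
a multiple of `r^(N-1)`, cancelling the denominator. Decay then comes from absolute continuity of
the integral of `|ρ|^N`. -/
theorem tendsto_flux_zero (hN : 0 < N) {ρ : E N → ℝ} {σ : ℝ≥0∞} (hσ : (N : ℝ≥0∞) ≤ σ) {δ : ℝ}
    (hδ : 0 < δ) (hρ : MemLp ρ σ (volume.restrict (Metric.ball (0 : E N) δ))) :
    Tendsto (fun r => ballMass ρ r / (sphereArea N * r ^ (N - 1))) (𝓝[>] 0) (𝓝 0) := by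
  have : Nonempty (Fin N) := ⟨⟨0, hN⟩⟩
  have hN0 : (N : ℝ≥0∞) ≠ 0 := by exact_mod_cast hN.ne'
  have hNt : (N : ℝ≥0∞) ≠ ⊤ := ENNReal.natCast_ne_top N
  have hN1 : (1 : ℝ≥0∞) ≤ N := by exact_mod_cast hN
  have hfin : IsFiniteMeasure ((volume : Measure (E N)).restrict (Metric.ball (0 : E N) δ)) :=
    ⟨by rw [Measure.restrict_apply_univ]; exact measure_ball_lt_top⟩
  have hρN : MemLp ρ N (volume.restrict (Metric.ball (0 : E N) δ)) := hρ.mono_exponent hσ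
  set v : ℝ := (volume : Measure (E N)).real (Metric.ball 0 1) with hv
  set A : ℝ → ℝ≥0∞ := fun r => eLpNorm ρ N (volume.restrict (Metric.ball (0 : E N) r)) with hA
  have hvol : ∀ r : ℝ, 0 ≤ r → volume (Metric.ball (0 : E N) r) = ENNReal.ofReal (r ^ N * v) := by
    intro r hr
    rw [Measure.addHaar_ball _ _ hr, finrank_euclideanSpace_fin, ENNReal.ofReal_mul (by positivity),
      hv, ofReal_measureReal measure_ball_lt_top.ne]
  have hAlim : Tendsto A (𝓝[>] 0) (𝓝 0) := by
    have hfinN : ∫⁻ x in Metric.ball (0 : E N) δ, ‖ρ x‖ₑ ^ (N : ℝ) ≠ ⊤ := by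
      have := (lintegral_rpow_enorm_lt_top_of_eLpNorm_lt_top hN0 hNt hρN.2).ne
      simpa using this
    have hsmall : Tendsto (fun r : ℝ => volume.restrict (Metric.ball (0 : E N) δ)
        (Metric.ball (0 : E N) r)) (𝓝[>] 0) (𝓝 0) := by
      have h1 : Tendsto (fun r : ℝ => ENNReal.ofReal (r ^ N * v)) (𝓝[>] 0) (𝓝 0) := by
        have h2 : Continuous fun r : ℝ => ENNReal.ofReal (r ^ N * v) :=
          ENNReal.continuous_ofReal.comp (by fun_prop)
        have h3 := (h2.tendsto 0).mono_left (nhdsWithin_le_nhds (s := Ioi 0))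
        simpa [hN.ne'] using h3
      refine tendsto_of_tendsto_of_tendsto_of_le_of_le' tendsto_const_nhds h1
        (Eventually.of_forall fun _ => zero_le) ?_
      filter_upwards [self_mem_nhdsWithin] with r hr
      rw [← hvol r (le_of_lt hr)]
      exact Measure.restrict_apply_le _ _
    have h4 := (tendsto_setLIntegral_zero hfinN hsmall).ennrpow_const (1 / (N : ℝ))
    rw [ENNReal.zero_rpow_of_pos (by positivity)] at h4
    refine h4.congr' ?_
    filter_upwards [Ioo_mem_nhdsGT hδ] with r hr
    rw [Measure.restrict_restrict Metric.isOpen_ball.measurableSet,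
      inter_eq_left.2 (Metric.ball_subset_ball hr.2.le), hA]
    simp only [eLpNorm_eq_lintegral_rpow_enorm_toReal hN0 hNt, ENNReal.toReal_natCast]
  have hbound : ∀ᶠ r in 𝓝[>] (0 : ℝ), |ballMass ρ r / (sphereArea N * r ^ (N - 1))| ≤
      (A r).toReal * (v ^ (1 - 1 / (N : ℝ)) / sphereArea N) := by
    filter_upwards [Ioo_mem_nhdsGT hδ] with r hr
    have hr0 : 0 < r := hr.1
    have hc := sphereArea_pos hN
    have hv0 : 0 ≤ v := measureReal_nonneg
    have hmem : MemLp ρ N (volume.restrict (Metric.ball (0 : E N) r)) :=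
      hρN.mono_measure (Measure.restrict_mono (Metric.ball_subset_ball hr.2.le) le_rfl)
    have h1 := eLpNorm_le_eLpNorm_mul_rpow_measure_univ hN1 hmem.1
    have hexp : 0 ≤ 1 - 1 / (N : ℝ) := by
      rw [sub_nonneg, div_le_one (by exact_mod_cast hN)]
      exact_mod_cast hN
    rw [Measure.restrict_apply_univ, hvol r hr0.le, ENNReal.toReal_one, ENNReal.toReal_natCast,
      div_one, ENNReal.ofReal_rpow_of_nonneg (by positivity) hexp] at h1
    have h2 := ENNReal.toReal_mono (ENNReal.mul_ne_top hmem.2.ne ENNReal.ofReal_ne_top) h1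
    rw [ENNReal.toReal_mul, ENNReal.toReal_ofReal (by positivity)] at h2
    have h3 : |ballMass ρ r| ≤
        (eLpNorm ρ 1 (volume.restrict (Metric.ball (0 : E N) r))).toReal := by
      rw [eLpNorm_one_eq_lintegral_enorm, ← integral_norm_eq_lintegral_enorm hmem.1]
      exact norm_integral_le_integral_norm ρ
    have h4 : (r ^ N * v) ^ (1 - 1 / (N : ℝ)) = r ^ (N - 1) * v ^ (1 - 1 / (N : ℝ)) := by
      rw [Real.mul_rpow (by positivity) hv0, ← Real.rpow_natCast r N, ← Real.rpow_mul hr0.le,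
        ← Real.rpow_natCast r (N - 1), Nat.cast_sub hN]
      congr 2
      field_simp
      simp
    rw [abs_div, abs_of_pos (mul_pos hc (pow_pos hr0 _)), div_le_iff₀ (mul_pos hc (pow_pos hr0 _))]
    refine (h3.trans h2).trans_eq ?_
    rw [h4]
    change (A r).toReal * _ = _
    field_simp
  have hlim : Tendsto (fun r => (A r).toReal * (v ^ (1 - 1 / (N : ℝ)) / sphereArea N))
      (𝓝[>] 0) (𝓝 0) := by
    have := ((ENNReal.tendsto_toReal ENNReal.zero_ne_top).comp hAlim).mul_const
      (v ^ (1 - 1 / (N : ℝ)) / sphereArea N)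
    simpa using this
  exact squeeze_zero_norm' hbound hlim

theorem tendsto_slope_zero (hN : 0 < N) {ρ : E N → ℝ} {σ : ℝ≥0∞} (hσ : (N : ℝ≥0∞) ≤ σ) {δ : ℝ}
    (hδ : 0 < δ) (hρ : MemLp ρ σ (volume.restrict (Metric.ball (0 : E N) δ))) :
    Tendsto (slope ρ) (𝓝[>] 0) (𝓝 0) := by
  have h := tendsto_flux_zero hN hσ hδ hρ
  have hc : Continuous fun q : ℝ => -q / √(1 + q ^ 2) :=
    continuous_neg.div (by fun_prop) fun q => (Real.sqrt_pos.2 (by positivity)).ne'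
  have h2 := (hc.tendsto 0).comp h
  rw [neg_zero, zero_div] at h2
  exact h2

/-- The direction `x / |x|` has no limit at the origin, but its coefficient `P(|x|)` tends to 0. -/
theorem contDiff_one_of_radial {φ : E N → ℝ} {f P : ℝ → ℝ} (hf : ∀ x, φ x = f ‖x‖)
    (hP : ContinuousOn P (Ioi 0)) (hP0 : Tendsto P (𝓝[>] 0) (𝓝 0))
    (hd : ∀ r, 0 < r → HasDerivAt f (P r) r) (hd0 : HasDerivWithinAt f 0 (Ici 0) 0) :
    ContDiff ℝ 1 φ := by
  have hfun : φ = fun y => f ‖y‖ := funext hf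
  have hgrad : ∀ x, HasGradientAt φ (P ‖x‖ • ‖x‖⁻¹ • x) x := fun x => by
    rw [hfun]
    by_cases hx : x = 0
    · subst hx
      rw [smul_zero, smul_zero, hasGradientAt_iff_isLittleO_nhds_zero]
      have h := hasDerivWithinAt_iff_isLittleO.1 hd0
      have ht : Tendsto (fun y : E N => ‖y‖) (𝓝 0) (𝓝[≥] 0) :=
        tendsto_nhdsWithin_iff.2 ⟨by simpa using (continuous_norm (E := E N)).tendsto 0,
          Eventually.of_forall fun y => norm_nonneg y⟩
      have h2 := h.comp_tendsto ht
      refine Asymptotics.IsLittleO.of_norm_right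
        (h2.congr' (Eventually.of_forall fun y => ?_) (Eventually.of_forall fun y => ?_))
      · simp [Function.comp]
      · simp [Function.comp]
    · exact hasGradientAt_comp_norm hx (hd _ (norm_pos_iff.2 hx))
  have hcont : Continuous fun x : E N => P ‖x‖ • ‖x‖⁻¹ • x := by
    refine continuous_iff_continuousAt.2 fun x => ?_
    by_cases hx : x = 0
    · subst hx
      rw [continuousAt_iff_punctured_nhds]
      rw [smul_zero, smul_zero]
      refine squeeze_zero_norm' (a := fun x : E N => |P ‖x‖|) ?_ ?_
      · filter_upwards [self_mem_nhdsWithin] with y hy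
        exact (norm_radial _ hy).le
      · simpa using (hP0.comp (tendsto_norm_nhdsNE_zero (E := E N))).abs
    · have hpos := norm_pos_iff.2 hx
      have h1 : ContinuousAt (fun y : E N => P ‖y‖) x :=
        ContinuousAt.comp (hP.continuousAt (Ioi_mem_nhds hpos)) continuous_norm.continuousAt
      exact h1.smul ((continuous_norm.continuousAt.inv₀ hpos.ne').smul continuousAt_id)
  rw [contDiff_one_iff_fderiv]
  refine ⟨fun x => (hgrad x).differentiableAt, ?_⟩
  have : fderiv ℝ φ = fun x => InnerProductSpace.toDual ℝ (E N) (P ‖x‖ • ‖x‖⁻¹ • x) :=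
    funext fun x => (hgrad x).hasFDerivAt.fderiv
  rw [this]
  exact (InnerProductSpace.toDual ℝ (E N)).continuous.comp hcont

end BornInfeld


/-! ### Conclusion -/

open BornInfeld in
theorem mainTheorem5 (N : ℕ) (hN : 3 ≤ N)
    (ρ : BornInfeld.E N → ℝ) (hrad : BornInfeld.IsRadial ρ)
    (s : ℝ≥0∞) (hs : 1 ≤ s) (hρs : MemLp ρ s volume)
    (σ : ℝ≥0∞) (hσ : (N : ℝ≥0∞) ≤ σ) (δ : ℝ) (hδ : 0 < δ)
    (hρσ : MemLp ρ σ (volume.restrict (Metric.ball (0 : BornInfeld.E N) δ)))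
    (T : BornInfeld.XDual N) (hT : T.IsGivenBy ρ)
    (φ : BornInfeld.E N → ℝ) (hφ : BornInfeld.IsWeakSolution T φ) :
    ContDiff ℝ 1 φ ∧
    ∃ f : ℝ → ℝ, (∀ x, φ x = f ‖x‖) ∧ ContDiffOn ℝ 1 f (Ici 0) ∧
      HasDerivWithinAt f 0 (Ici 0) 0 ∧
      ∀ K : Set ℝ, IsCompact K → K ⊆ Ioi 0 →
        ∃ ε : ℝ, 0 < ε ∧ ∀ r ∈ K, |deriv f r| ≤ 1 - ε := by
  have hN0 : 0 < N := by omega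
  have : Nonempty (Fin N) := ⟨⟨0, hN0⟩⟩
  obtain ⟨e, he⟩ := exists_norm_eq (BornInfeld.E N) zero_le_one
  obtain ⟨⟨L, hL⟩, -, -⟩ := id hφ.1
  have hρ : LocallyIntegrable ρ volume := hρs.locallyIntegrable hs
  set f : ℝ → ℝ := fun r => φ (r • e) with hf_def
  have hf : ∀ x, φ x = f ‖x‖ := fun x =>
    hφ.eq_of_norm_eq hN hrad hT (by rw [norm_smul, he, norm_norm, mul_one])
  have hflip : LipschitzWith (L * 1) f := by
    refine hL.comp (LipschitzWith.of_dist_le_mul fun s t => ?_)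
    rw [dist_eq_norm, ← sub_smul, norm_smul, he, dist_eq_norm]
    simp
  have hP := continuousOn_slope hN0 hρ
  have hP0 := tendsto_slope_zero hN0 hσ hδ hρσ
  have hd : ∀ r, 0 < r → HasDerivAt f (slope ρ r) r := fun r hr =>
    hasDerivAt_of_deriv_ae_eq hflip hP (hφ.deriv_ae_eq_slope hN0 hρ hT hf) hr
  have hd0 : HasDerivWithinAt f 0 (Ici 0) 0 := by
    -- A limit of `f'` at `0⁺`, with continuity of `f`, gives the one-sided derivative.
    refine hasDerivWithinAt_Ici_of_tendsto_deriv (s := Ioi 0)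
      (fun r hr => (hd r hr).differentiableAt.differentiableWithinAt)
      hflip.continuous.continuousWithinAt self_mem_nhdsWithin (hP0.congr' ?_)
    filter_upwards [self_mem_nhdsWithin] with r hr
    exact (hd r hr).deriv.symm
  have hC := contDiff_one_of_radial hf hP hP0 hd hd0
  refine ⟨hC, f, hf, (hC.comp (by fun_prop : ContDiff ℝ 1 fun r : ℝ => r • e)).contDiffOn, hd0,
    fun K hK hK0 => ?_⟩
  rcases K.eq_empty_or_nonempty with rfl | hne
  · exact ⟨1, one_pos, by simp⟩
  -- The continuous function `|slope ρ|` attains its maximum on `K`, and that value is below 1.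
  obtain ⟨r₀, hr₀, hmax⟩ := hK.exists_isMaxOn hne (hP.mono hK0).abs
  refine ⟨1 - |slope ρ r₀|, sub_pos.2 (abs_neg_div_sqrt_lt_one _), fun r hr => ?_⟩
  rw [(hd r (hK0 hr)).deriv, sub_sub_cancel]
  exact hmax hr
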